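/- All logarithms are base two and $H(q)=-q\log q-(1-q)\log(1-q)$. Fix $p\in(0,1/2)$. There is $\varepsilon_0=\varepsilon_0(p)>0$ such that the following holds for every $\varepsilon\in(0,\varepsilon_0]$ with $p+\varepsilon\le 1/2$. **Parameters.** Let $R=H(p+\varepsilon)$, $p_\varepsilon=p+\varepsilon/2$, let $\varepsilon'\in[0,1/2)$ satisfy $H(\varepsilon')=(R-H(p_\varepsilon))/2$, and put $N=\lceil nR\rceil$, $b=b_n=\lceil 100\log n/\varepsilon'\rceil$. Let $g=g_n:\{0,1\}^{b}\to\{0,1\}^{b'}$, $g(v)=Mv$ over $\mathbb F_2$, where $b'=b'_n$ satisfies $b'/b\to 1$ and $M=M_n$ is a parity-check matrix (with linearly independent rows) of a linear code whose dual code, the row space of $M$, has minimum distance at least $3$; equivalently, any two coordinates of a uniformly random element of any fibre of $g$ are independent uniform bits. **Random decoder.** Independently and uniformly choose sets $\mathcal I_1,\dots,\mathcal I_n\subseteq[N]$ of size $b$ (the graph $\mathcal G$) and sets $A_1,\dots,A_n\subseteq\{0,1\}^{b'}$ of size $\lceil p2^{b'}\rceil$, and let $f_i=1_{A_i}\circ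 g$. For $c\in\{0,1\}^N$, $c_{\mathcal I_i}\in\{0,1\}^b$ is its restriction to $\mathcal I_i$. For $x\in\{0,1\}^n$ let $\mathcal C(x)=\{c: f_i(c_{\mathcal I_i})=x_i\ \forall i\}$ be the set of valid codewords. **Block marginals.** Let $\mathcal P$ be the set of $\phi=(\phi^{(1)},\dots,\phi^{(n)})\in\mathbb R^{n2^b}$ such that every $\phi^{(i)}$ is a probability mass function on $\{0,1\}^b$. For a distribution $P$ on $\{0,1\}^N$, $\phi_P\in\mathcal P$ is the vector whose $i$-th block is the law of $c_{\mathcal I_i}$ under $P$. A vector is *generated* if it lies in $\mathcal P_{\mathcal G}=\{\phi_P\}$, the convex hull of the vectors $\phi_c$ of single codewords. The ideal vector $\phi_{I,x}$ has $i$-th block uniform on $f_i^{-1}(x_i)$. For $\ell,m\in\mathcal I_i$ let $\phi^{(i)}_{\ell}(a)$ and $\phi^{(i)}_{\ell,m}(a_1,a_2)$ be the sums of $\phi^{(i)}(c^b)$ over $c^b$ with $c_\ell=a$, respectively $c_\ell=a_1,c_m=a_2$; $\phi$ is *bit consistent* (*bit-pair consistent*) if for all $i\ne j$ these agree for blocks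 $i$ and $j$ at all $\ell$ (all $\ell,m$) in $\mathcal I_i\cap\mathcal I_j$. **Eligible perturbations.** $\mathcal E_{\mathcal G}$ is the set of $\eta=\phi-\phi'$ with $\phi,\phi'\in\mathcal P$ both bit consistent and bit-pair consistent, such that (1) $|\eta^{(i)}_{\ell,m}(a_1,a_2)|\le n^{-4}$ for all $i\neq j$, $\ell,m\in\mathcal I_i\cap\mathcal I_j$, $a_1,a_2\in\{0,1\}$; (2) $\eta^{(i)}(c^b)\le \frac1{n^2|f_i^{-1}(x_i)|}$ for all $i$ and $c^b\in\{0,1\}^b$. **Expurgation.** For $\tau>0$ let $\mathcal C_{\tau}(x)$ be obtained from $\mathcal C(x)$ by deleting every $c$ that lies, for some $i$, in a cylinder $\{c'\in\mathcal C(x): c'_{\mathcal I_i}=v\}$ containing more than a fraction $\frac1{|f_i^{-1}(x_i)|}+\tau$ of $\mathcal C(x)$. **Claim.** There is a sequence $\delta_n\to0$ (not depending on $x$) such that for all $n\ge1$ and all $x\in\{0,1\}^n$ of Hamming weight at most $np_\varepsilon$, with probability at least $1-\frac{1+\delta_n}{n^2}$ over $(\mathcal G,f)$ there is $\eta\in\mathcal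 E_{\mathcal G}$ such that $\phi_{I,x}+\eta\in\mathcal P_{\mathcal G}$ and, for some $0<\tau\le\frac1{n2^b}$, $\mathcal C_\tau(x)\neq\emptyset$ and $\phi_{I,x}+\eta$ is the block-marginal vector of the uniform distribution on $\mathcal C_\tau(x)$. -/

import Mathlib

open Filter Topology

noncomputable section

namespace PrivateDecoding

/-- Binary strings of length `k`. -/
abbrev Bits (k : ℕ) : Type := Fin k → ZMod 2

/-- Binary entropy in bits. -/
def H2 (q : ℝ) : ℝ := Real.binEntropy q / Real.log 2

/-- A bipartite graph with `N` left vertices (codeword components) and `n` right vertices,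
each right vertex `i` being joined to a set of exactly `b` left vertices. -/
abbrev Graph (n N b : ℕ) : Type := Fin n → {s : Finset (Fin N) // s.card = b}

/-- The neighbourhood `I_i` of the right vertex `i`. -/
def Graph.nbr {n N b : ℕ} (G : Graph n N b) (i : Fin n) : Finset (Fin N) := (G i).1

/-- The increasing enumeration of `I_i`. -/
def Graph.pos {n N b : ℕ} (G : Graph n N b) (i : Fin n) (k : Fin b) : Fin N :=
  (G i).1.orderEmbOfFin (G i).2 k

/-- The block `c_{I_i}` of a codeword `c`, as a string of length `b`. -/
def Graph.view {n N b : ℕ} (G : Graph n N b) (i : Fin n) (c : Bits N) : Bits b :=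
  fun k => c (G.pos i k)

/-- Local decoding functions, one for each right vertex. -/
abbrev LocalMaps (n b : ℕ) : Type := Fin n → Bits b → ZMod 2

/-- Vectors indexed by pairs (block `i`, string of length `b`). -/
abbrev BlockVec (n b : ℕ) : Type := Fin n → Bits b → ℝ

/-- The block-marginal polytope: each block is a probability mass function. -/
def polytope (n b : ℕ) : Set (BlockVec n b) :=
  {φ | (∀ i v, 0 ≤ φ i v) ∧ ∀ i, ∑ v, φ i v = 1}

/-- The block-marginal vector of a single codeword. -/
def codewordVec {n N b : ℕ} (G : Graph n N b) (c : Bits N) : BlockVec n b :=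
  fun i v => if G.view i c = v then 1 else 0

/-- The block-marginal vector of a distribution `P` on codewords. -/
def distVec {n N b : ℕ} (G : Graph n N b) (P : Bits N → ℝ) : BlockVec n b :=
  ∑ c, P c • codewordVec G c

/-- The block-marginal vectors that can be generated. -/
def generated {n N b : ℕ} (G : Graph n N b) : Set (BlockVec n b) :=
  convexHull ℝ (Set.range (codewordVec G))

/-- The uniform distribution on a (nonempty) set of codewords. -/
def uniformDist {N : ℕ} (S : Finset (Bits N)) : Bits N → ℝ :=
  fun c => if c ∈ S then 1 / (S.card : ℝ) else 0

/-- `|f_i⁻¹(y)|`. -/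
def fibreCard {n b : ℕ} (f : LocalMaps n b) (i : Fin n) (y : ZMod 2) : ℕ :=
  (Finset.univ.filter fun v : Bits b => f i v = y).card

/-- The ideal block-marginal vector: block `i` is uniform on `f_i⁻¹(x_i)`. -/
def idealVec {n b : ℕ} (f : LocalMaps n b) (x : Bits n) : BlockVec n b :=
  fun i v => if f i v = x i then 1 / (fibreCard f i (x i) : ℝ) else 0

/-- The marginal of block `i` with respect to the codeword bit `l ∈ I_i`. -/
def bitMarginal {n N b : ℕ} (G : Graph n N b) (φ : BlockVec n b) (i : Fin n)
    (l : Fin N) (a : ZMod 2) : ℝ :=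
  ∑ v ∈ Finset.univ.filter (fun v : Bits b => ∀ k, G.pos i k = l → v k = a), φ i v

/-- The marginal of block `i` with respect to the pair of codeword bits `l, m ∈ I_i`. -/
def pairMarginal {n N b : ℕ} (G : Graph n N b) (φ : BlockVec n b) (i : Fin n)
    (l m : Fin N) (a₁ a₂ : ZMod 2) : ℝ :=
  ∑ v ∈ Finset.univ.filter
    (fun v : Bits b => (∀ k, G.pos i k = l → v k = a₁) ∧ (∀ k, G.pos i k = m → v k = a₂)), φ i v

def BitConsistent {n N b : ℕ} (G : Graph n N b) (φ : BlockVec n b) : Prop :=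
  ∀ i j, i ≠ j → ∀ l ∈ G.nbr i ∩ G.nbr j, ∀ a,
    bitMarginal G φ i l a = bitMarginal G φ j l a

def BitPairConsistent {n N b : ℕ} (G : Graph n N b) (φ : BlockVec n b) : Prop :=
  ∀ i j, i ≠ j → 2 ≤ (G.nbr i ∩ G.nbr j).card →
    ∀ l ∈ G.nbr i ∩ G.nbr j, ∀ m ∈ G.nbr i ∩ G.nbr j, ∀ a₁ a₂,
      pairMarginal G φ i l m a₁ a₂ = pairMarginal G φ j l m a₁ a₂

/-- The set of eligible perturbations. -/
def eligible {n N b : ℕ} (G : Graph n N b) (f : LocalMaps n b) (x : Bits n) :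
    Set (BlockVec n b) :=
  {η | (∃ φ ∈ polytope n b, ∃ φ' ∈ polytope n b,
          BitConsistent G φ ∧ BitPairConsistent G φ ∧
          BitConsistent G φ' ∧ BitPairConsistent G φ' ∧ η = φ - φ') ∧
       (∀ i j, i ≠ j → ∀ l ∈ G.nbr i ∩ G.nbr j, ∀ m ∈ G.nbr i ∩ G.nbr j, ∀ a₁ a₂,
          |pairMarginal G η i l m a₁ a₂| ≤ 1 / (n : ℝ) ^ 4) ∧
       (∀ i v, η i v ≤ 1 / ((n : ℝ) ^ 2 * (fibreCard f i (x i) : ℝ)))}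

/-- The valid codewords for `x`: those decoded to `x`. -/
def validCodewords {n N b : ℕ} (G : Graph n N b) (f : LocalMaps n b) (x : Bits n) :
    Finset (Bits N) :=
  Finset.univ.filter fun c => ∀ i, f i (G.view i c) = x i

/-- The cylinder of valid codewords whose `i`-th block is `v`. -/
def cylinder {n N b : ℕ} (G : Graph n N b) (f : LocalMaps n b) (x : Bits n)
    (i : Fin n) (v : Bits b) : Finset (Bits N) :=
  (validCodewords G f x).filter fun c => G.view i c = v

/-- The cylinder of `(i, v)` is bad at tolerance `τ` if it contains more than a fraction
`1 / |f_i⁻¹(x_i)| + τ` of the valid codewords. -/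
def BadCylinder {n N b : ℕ} (G : Graph n N b) (f : LocalMaps n b) (x : Bits n) (τ : ℝ)
    (i : Fin n) (v : Bits b) : Prop :=
  1 / (fibreCard f i (x i) : ℝ) + τ <
    ((cylinder G f x i v).card : ℝ) / ((validCodewords G f x).card : ℝ)

open Classical in
/-- The valid codewords that lie in no bad cylinder. -/
def expurgated {n N b : ℕ} (G : Graph n N b) (f : LocalMaps n b) (x : Bits n) (τ : ℝ) :
    Finset (Bits N) :=
  (validCodewords G f x).filter fun c => ∀ i, ¬ BadCylinder G f x τ i (G.view i c)

/-- The sample space of the decoder ensemble: `n` neighbourhoods of size `b` and `n` subsets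
of `{0,1}^{b'}` of size `K`. The uniform law on it makes all `2n` choices independent
and uniform. -/
abbrev Ensemble (n N b b' K : ℕ) : Type :=
  Graph n N b × (Fin n → {A : Finset (Bits b') // A.card = K})

/-- The local decoding functions `f_i = 1_{A_i} ∘ g` with `g v = M v`. -/
def decoderMaps {n b b' K : ℕ} (M : Matrix (Fin b') (Fin b) (ZMod 2))
    (A : Fin n → {A : Finset (Bits b') // A.card = K}) : LocalMaps n b :=
  fun i v => if M.mulVec v ∈ (A i).1 then 1 else 0

/-- Probability of an event under the uniform law on the ensemble. -/
def ensembleProb {n N b b' K : ℕ} (E : Ensemble n N b b' K → Prop) : ℝ :=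
  (Nat.card {ω : Ensemble n N b b' K // E ω} : ℝ) / (Nat.card (Ensemble n N b b' K) : ℝ)

/-- The codeword length for blocklength `n` and rate `R`. -/
def codeLen (R : ℝ) (n : ℕ) : ℕ := ⌈(n : ℝ) * R⌉₊

/-- The right degree `100 log n / ε'` (logarithm in base two), rounded up. -/
def blockLen (ε' : ℝ) (n : ℕ) : ℕ := ⌈100 * Real.logb 2 n / ε'⌉₊

/-- `⌈p 2^{b'}⌉`, the number of preimages of `1`. -/
def onesCount (p : ℝ) (b' : ℕ) : ℕ := ⌈p * 2 ^ b'⌉₊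

/-- `M` is a parity-check matrix (with linearly independent rows) of a linear code whose
dual code, the row space of `M`, has minimum distance at least three. Equivalently, any two
coordinates of a uniformly chosen vector in any fibre of `v ↦ M v` are uniform. -/
def PairBalanced {b b' : ℕ} (M : Matrix (Fin b') (Fin b) (ZMod 2)) : Prop :=
  ∀ u : Bits b', u ≠ 0 → 3 ≤ hammingNorm (M.vecMul u)

end PrivateDecoding

end

/-! Fix `x` and let Z(i,v) be the number of valid codewords whose i-th block is v. The theorem rests
on a second moment estimate: with high probability, for every i the function Z(i,·), which vanishes
off the fibre of `x i`, is ℓ¹-close to a constant on that fibre.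

Given this, the rest is deterministic (`exists_eligible_of_near`). Bad cylinders carry little mass,
so expurgation barely moves the block marginals, and a small ℓ¹ distance to the ideal vector bounds
all pair marginals. The pointwise upper bound does not follow from ℓ¹ closeness; it holds because
every surviving cylinder is not bad. Marginals of a genuine distribution are consistent, and the
ideal vector is consistent because `PairBalanced` makes any two of its bits independent and fair.

For the second moment, the sum over v of Z(i,v)² counts pairs (c, c') of valid codewords agreeing on
block i, and its expectation factors over the independent blocks. Within a block, two distinct
syndromes are negatively correlated, since `A` is drawn without replacement; positive correlation
needs `M` to annihilate d = c - c' on the random index set. If this has probability at most n⁻⁶⁰,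
the pair behaves almost as if independent (`prod_block_le`). The other differences are bad, and are
handled by counting them.

A bad d contains some word of the small kernel of `M` unusually often as a subsequence.
`sum_occ_pow_le` bounds all moments of the number of occurrences, and Markov's inequality at a tuned
exponent leaves at most exp(N h(ε')) poly(n) bad differences (`card_badDiff_le_exp`), h being
entropy in nats. Their contribution is negligible when N (log 2 - h(ε')) exceeds n times
`crossEntropy (p + ε / 2) p`, the exponent of the validity probability. At ε = 0 the two rates
coincide, and a derivative computation shows that the inequality is strict for small ε > 0
(`exists_entropy_gap`). -/

noncomputable section

namespace PrivateDecoding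

/-! ### Moments of subsequence counts -/

/-- The number of occurrences of `v` as a subsequence of `d`. -/
def occ {N b : ℕ} (d : Bits N) (v : Bits b) : ℕ :=
  (Finset.univ.filter fun e : Fin b → Fin N => StrictMono e ∧ ∀ k, d (e k) = v k).card

theorem occ_zero_right {N : ℕ} (d : Bits N) (v : Bits 0) : occ d v ≤ 1 := by
  unfold occ
  refine (Finset.card_le_univ _).trans ?_
  simp

theorem occ_zero_left {b : ℕ} (d : Bits 0) (v : Bits (b + 1)) : occ d v = 0 := by
  unfold occ
  rw [Finset.card_eq_zero, Finset.filter_eq_empty_iff]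
  intro e
  exact (e 0).elim0

/-- An embedding either avoids position 0, and shifts down, or sends its first index to 0, which
forces `a = v 0` and leaves an occurrence of the tail. -/
theorem occ_cons_le {N b : ℕ} (a : ZMod 2) (d : Bits N) (v : Bits (b + 1)) :
    occ (Fin.cons a d : Bits (N + 1)) v ≤
      occ d v + if a = v 0 then occ d (Fin.tail v) else 0 := by
  classical
  set S := Finset.univ.filter fun e : Fin (b + 1) → Fin N => StrictMono e ∧ ∀ k, d (e k) = v k
  set S' := Finset.univ.filter fun e : Fin b → Fin N =>
    StrictMono e ∧ ∀ k, d (e k) = Fin.tail v k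
  have hsub : (Finset.univ.filter fun e : Fin (b + 1) → Fin (N + 1) =>
      StrictMono e ∧ ∀ k, (Fin.cons a d : Bits (N + 1)) (e k) = v k) ⊆
      S.image (fun e => Fin.succ ∘ e) ∪
        if a = v 0 then S'.image (fun e => Fin.cons 0 (Fin.succ ∘ e)) else ∅ := by
    intro e he
    obtain ⟨hm, hv⟩ := (Finset.mem_filter.1 he).2
    rw [Finset.mem_union]
    by_cases h0 : e 0 = 0
    · right
      have ha : a = v 0 := by simpa [h0] using hv 0
      rw [if_pos ha, Finset.mem_image]
      have hne : ∀ k : Fin b, e k.succ ≠ 0 := fun k =>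
        ((Fin.zero_le (e 0)).trans_lt (hm (Fin.succ_pos k))).ne'
      refine ⟨fun k => (e k.succ).pred (hne k), ?_, ?_⟩
      · refine Finset.mem_filter.2 ⟨Finset.mem_univ _, fun i j hij => ?_, fun k => ?_⟩
        · exact Fin.pred_lt_pred_iff.2 (hm (Fin.succ_lt_succ_iff.2 hij))
        · have := hv k.succ
          rw [← Fin.succ_pred (e k.succ) (hne k), Fin.cons_succ] at this
          exact this
      · funext k
        refine Fin.cases ?_ (fun k => ?_) k
        · simp [h0]
        · simp
    · left
      have hne : ∀ k, e k ≠ 0 := fun k =>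
        ((Fin.pos_iff_ne_zero.2 h0).trans_le (hm.monotone (Fin.zero_le k))).ne'
      refine Finset.mem_image.2 ⟨fun k => (e k).pred (hne k), ?_, ?_⟩
      · refine Finset.mem_filter.2 ⟨Finset.mem_univ _, fun i j hij => ?_, fun k => ?_⟩
        · exact Fin.pred_lt_pred_iff.2 (hm hij)
        · have := hv k
          rw [← Fin.succ_pred (e k) (hne k), Fin.cons_succ] at this
          exact this
      · funext k
        simp
  refine (Finset.card_le_card hsub).trans ((Finset.card_union_le _ _).trans ?_)
  refine add_le_add Finset.card_image_le ?_
  split_ifs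
  · exact Finset.card_image_le
  · simp

/-- Convexity of the power function at the weights 1/(1+w) and w/(1+w). -/
theorem add_mul_pow_le {X Y w : ℝ} (hX : 0 ≤ X) (hY : 0 ≤ Y) (hw : 0 ≤ w) (s : ℕ) :
    (X + w * Y) ^ (s + 1) ≤ (1 + w) ^ s * (X ^ (s + 1) + w * Y ^ (s + 1)) := by
  have h1 : (0 : ℝ) < 1 + w := by linarith
  have h := (convexOn_pow (𝕜 := ℝ) (s + 1)).2 (Set.mem_Ici.2 hX) (Set.mem_Ici.2 hY)
    (show 0 ≤ 1 / (1 + w) by positivity) (show 0 ≤ w / (1 + w) by positivity)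
    (by field_simp)
  simp only [smul_eq_mul] at h
  have e1 : 1 / (1 + w) * X + w / (1 + w) * Y = (X + w * Y) / (1 + w) := by field_simp
  have e2 : 1 / (1 + w) * X ^ (s + 1) + w / (1 + w) * Y ^ (s + 1) =
      (X ^ (s + 1) + w * Y ^ (s + 1)) / (1 + w) := by field_simp
  rw [e1, e2, div_pow, div_le_div_iff₀ (by positivity) h1, pow_succ (1 + w)] at h
  have h' : (X + w * Y) ^ (s + 1) * (1 + w) ≤
      ((1 + w) ^ s * (X ^ (s + 1) + w * Y ^ (s + 1))) * (1 + w) := by linarith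
  exact le_of_mul_le_mul_right h' h1

/-- Moment bound for the number of occurrences of a fixed string as a subsequence. -/
theorem sum_occ_pow_le {w : ℝ} (hw : 0 ≤ w) (s : ℕ) :
    ∀ (N b : ℕ) (v : Bits b),
      ∑ d : Bits N, (w ^ b * (occ d v : ℝ)) ^ (s + 1) ≤ (1 + (1 + w) ^ (s + 1)) ^ N := by
  intro N
  induction N with
  | zero =>
    intro b v
    cases b with
    | zero =>
      simp only [pow_zero, one_mul, Finset.univ_unique, Finset.sum_singleton]
      exact pow_le_one₀ (by positivity) (by exact_mod_cast occ_zero_right _ v)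
    | succ b =>
      simp [occ_zero_left]
  | succ N ih =>
    intro b v
    cases b with
    | zero =>
      have h2 : (2 : ℝ) ≤ 1 + (1 + w) ^ (s + 1) := by
        have : (1 : ℝ) ≤ (1 + w) ^ (s + 1) := one_le_pow₀ (by linarith)
        linarith
      calc ∑ d : Bits (N + 1), (w ^ 0 * (occ d v : ℝ)) ^ (s + 1)
          ≤ ∑ d : Bits (N + 1), (1 : ℝ) := by
            refine Finset.sum_le_sum fun d _ => ?_
            rw [pow_zero, one_mul]
            exact pow_le_one₀ (by positivity) (by exact_mod_cast occ_zero_right d v)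
        _ = 2 ^ (N + 1) := by simp [ZMod.card]
        _ ≤ _ := pow_le_pow_left₀ (by norm_num) h2 _
    | succ b =>
      set X : Bits N → ℝ := fun d => w ^ (b + 1) * (occ d v : ℝ)
      set Y : Bits N → ℝ := fun d => w ^ b * (occ d (Fin.tail v) : ℝ)
      have hX : ∀ d, 0 ≤ X d := fun d => by positivity
      have hY : ∀ d, 0 ≤ Y d := fun d => by positivity
      have hstep : ∀ (a : ZMod 2) (d : Bits N),
          (w ^ (b + 1) * (occ (Fin.cons a d : Bits (N + 1)) v : ℝ)) ^ (s + 1) ≤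
            (X d + w * (if a = v 0 then Y d else 0)) ^ (s + 1) := by
        intro a d
        refine pow_le_pow_left₀ (by positivity) ?_ _
        have h : (occ (Fin.cons a d : Bits (N + 1)) v : ℝ) ≤
            occ d v + if a = v 0 then (occ d (Fin.tail v) : ℝ) else 0 := by
          have := occ_cons_le a d v
          split_ifs at this ⊢ <;> exact_mod_cast this
        calc w ^ (b + 1) * (occ (Fin.cons a d : Bits (N + 1)) v : ℝ)
            ≤ w ^ (b + 1) * (occ d v + if a = v 0 then (occ d (Fin.tail v) : ℝ) else 0) := by
              gcongr
          _ = X d + w * (if a = v 0 then Y d else 0) := by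
              simp only [X, Y]; split_ifs <;> ring
      have hsplit : ∑ d : Bits (N + 1), (w ^ (b + 1) * (occ d v : ℝ)) ^ (s + 1) =
          ∑ a : ZMod 2, ∑ d : Bits N,
            (w ^ (b + 1) * (occ (Fin.cons a d : Bits (N + 1)) v : ℝ)) ^ (s + 1) := by
        rw [← Fintype.sum_prod_type']
        exact (Fintype.sum_equiv (Fin.consEquiv fun _ => ZMod 2) _ _ fun _ => rfl).symm
      rw [hsplit]
      calc _ ≤ ∑ a : ZMod 2, ∑ d : Bits N,
              (X d + w * (if a = v 0 then Y d else 0)) ^ (s + 1) :=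
            Finset.sum_le_sum fun a _ => Finset.sum_le_sum fun d _ => hstep a d
        -- Exactly one of the two possible first bits equals `v 0`; the other contributes only `X`.
        _ = ∑ d, X d ^ (s + 1) + ∑ d, (X d + w * Y d) ^ (s + 1) := by
            rw [← Finset.add_sum_erase _ _ (Finset.mem_univ (v 0)), add_comm]
            congr 1
            · have : (Finset.univ.erase (v 0)).card = 1 := by
                rw [Finset.card_erase_of_mem (Finset.mem_univ _)]; simp [ZMod.card]
              obtain ⟨a, ha⟩ := Finset.card_eq_one.1 this
              have hne : a ≠ v 0 := Finset.ne_of_mem_erase (ha ▸ Finset.mem_singleton_self a)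
              rw [ha, Finset.sum_singleton]
              simp [hne]
            · simp
        -- After convexity the recursion no longer sees `v`. The final bound is what a constant word
        -- gives: its occurrences in a string with z matching bits number C(z,b), and C(z,b) wᵇ ≤
        -- (1+w)ᶻ.
        _ ≤ ∑ d, X d ^ (s + 1) +
              ∑ d, (1 + w) ^ s * (X d ^ (s + 1) + w * Y d ^ (s + 1)) := by
            gcongr with d
            exact add_mul_pow_le (hX d) (hY d) hw s
        _ = ∑ d, X d ^ (s + 1) +
              (1 + w) ^ s * (∑ d, X d ^ (s + 1) + w * ∑ d, Y d ^ (s + 1)) := by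
            rw [← Finset.mul_sum, Finset.sum_add_distrib, Finset.mul_sum (a := w)]
        _ ≤ (1 + (1 + w) ^ (s + 1)) ^ N + (1 + w) ^ s *
              ((1 + (1 + w) ^ (s + 1)) ^ N + w * (1 + (1 + w) ^ (s + 1)) ^ N) := by
            have h1 := ih (b + 1) v
            have h2 := ih b (Fin.tail v)
            gcongr
        _ = (1 + (1 + w) ^ (s + 1)) ^ (N + 1) := by ring

/-- The binomial probability of the mean is at least `1 / (N + 1)`. -/
theorem pow_le_choose_mul_pow {N b : ℕ} (hb : b < N) :
    (1 + (b : ℝ) / (N - b : ℝ)) ^ N ≤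
      (N + 1) * (N.choose b * ((b : ℝ) / (N - b : ℝ)) ^ b) := by
  have hNb : (0 : ℝ) < N - b := by
    have : (b : ℝ) < N := by exact_mod_cast hb
    linarith
  -- These are the odds of success probability b/N, for which the binomial terms `t k` peak at k =
  -- b.
  set w : ℝ := (b : ℝ) / (N - b : ℝ)
  have hw : 0 ≤ w := by positivity
  set t : ℕ → ℝ := fun k => N.choose k * w ^ k
  have ht : ∀ k, 0 ≤ t k := fun k => by positivity
  have hrec : ∀ k, k < N → (k + 1 : ℝ) * t (k + 1) = (N - k) * w * t k := by
    intro k hk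
    have h : (N.choose (k + 1) : ℝ) * (k + 1) = N.choose k * (N - k) := by
      have := Nat.choose_succ_right_eq N k
      have h' : ((N.choose (k + 1) * (k + 1) : ℕ) : ℝ) = (N.choose k * (N - k) : ℕ) := by
        rw [this]
      rw [Nat.cast_mul, Nat.cast_mul, Nat.cast_sub hk.le] at h'
      exact_mod_cast h'
    simp only [t]
    rw [pow_succ]
    linear_combination w ^ k * w * h
  have hup : ∀ k, k + 1 ≤ b → t k ≤ t (k + 1) := by
    intro k hk
    have hk' : (k : ℝ) + 1 ≤ b := by exact_mod_cast hk
    have h := hrec k (by omega)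
    have h2 : (k + 1 : ℝ) ≤ (N - k) * w := by
      simp only [w]
      rw [mul_div_assoc', le_div_iff₀ hNb]
      nlinarith
    have h3 : (k + 1 : ℝ) * t k ≤ (k + 1) * t (k + 1) := by
      rw [h]; exact mul_le_mul_of_nonneg_right h2 (ht k)
    exact le_of_mul_le_mul_left h3 (by positivity)
  have hdown : ∀ k, b ≤ k → k < N → t (k + 1) ≤ t k := by
    intro k hk hkN
    have hk' : (b : ℝ) ≤ k := by exact_mod_cast hk
    have h := hrec k hkN
    have h2 : (N - k) * w ≤ (k + 1 : ℝ) := by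
      simp only [w]
      rw [mul_div_assoc', div_le_iff₀ hNb]
      have : (b : ℝ) < N := by exact_mod_cast hb
      nlinarith
    have h3 : (k + 1 : ℝ) * t (k + 1) ≤ (k + 1) * t k := by
      rw [h]; exact mul_le_mul_of_nonneg_right h2 (ht k)
    exact le_of_mul_le_mul_left h3 (by positivity)
  have hmax : ∀ k ≤ N, t k ≤ t b := by
    intro k hk
    rcases le_total k b with h | h
    · exact Nat.decreasingInduction (motive := fun k _ => t k ≤ t b)
        (fun j hj ih => (hup j hj).trans ih) le_rfl h
    · induction k, h using Nat.le_induction with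
      | base => exact le_rfl
      | succ j hj ih => exact (hdown j hj hk).trans (ih (by omega))
  rw [add_comm, add_pow]
  calc ∑ k ∈ Finset.range (N + 1), w ^ k * 1 ^ (N - k) * (N.choose k : ℝ)
      ≤ ∑ k ∈ Finset.range (N + 1), t b := by
        refine Finset.sum_le_sum fun k hk => ?_
        have := hmax k (by simpa [Nat.lt_succ_iff] using hk)
        simp only [t] at this ⊢
        rw [one_pow, mul_one, mul_comm]
        exact this
    _ = _ := by simp [t]

/-- Markov's inequality for the moment of order `s + 1`; `s` stays free so that it can be tuned to
ε' later. -/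
theorem card_occ_gt_le {N b : ℕ} (hb : b < N) (v : Bits b) {q : ℝ} (hq : 0 < q) (s : ℕ) :
    ((Finset.univ.filter fun d : Bits N => q * N.choose b < occ d v).card : ℝ) ≤
      (1 + 1 / (1 + (b : ℝ) / (N - b : ℝ)) ^ (s + 1)) ^ N * ((N + 1) / q) ^ (s + 1) := by
  have hNb : (0 : ℝ) < N - b := by
    have : (b : ℝ) < N := by exact_mod_cast hb
    linarith
  have hch := pow_le_choose_mul_pow hb
  set w : ℝ := (b : ℝ) / (N - b : ℝ)
  have hw : 0 ≤ w := by positivity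
  set S := Finset.univ.filter fun d : Bits N => q * N.choose b < occ d v
  set B : ℝ := q * (1 + w) ^ N / (N + 1)
  have hB : 0 < B := by positivity
  have h1 : (S.card : ℝ) * B ^ (s + 1) ≤ (1 + (1 + w) ^ (s + 1)) ^ N := by
    refine le_trans ?_ (sum_occ_pow_le hw s N b v)
    calc (S.card : ℝ) * B ^ (s + 1) = ∑ d ∈ S, B ^ (s + 1) := by simp
      _ ≤ ∑ d ∈ S, (w ^ b * (occ d v : ℝ)) ^ (s + 1) := by
          refine Finset.sum_le_sum fun d hd => pow_le_pow_left₀ hB.le ?_ _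
          have hd' := (Finset.mem_filter.1 hd).2
          calc B ≤ q * (N.choose b * w ^ b) := by
                simp only [B]
                rw [div_le_iff₀ (by positivity)]
                calc q * (1 + w) ^ N ≤ q * ((N + 1) * (N.choose b * w ^ b)) := by gcongr
                  _ = _ := by ring
            _ = w ^ b * (q * N.choose b) := by ring
            _ ≤ w ^ b * occ d v := by gcongr
      _ ≤ _ := Finset.sum_le_sum_of_subset_of_nonneg (Finset.subset_univ _)
          fun d _ _ => by positivity
  rw [← le_div_iff₀ (by positivity)] at h1
  refine h1.trans (le_of_eq ?_)
  simp only [B]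
  have hr : (1 + 1 / (1 + w) ^ (s + 1)) = (1 + (1 + w) ^ (s + 1)) / (1 + w) ^ (s + 1) := by
    field_simp; ring
  rw [hr, div_pow, div_pow, div_pow, mul_pow, ← pow_mul, ← pow_mul, mul_comm (s + 1) N]
  field_simp

/-! ### Fibres of the parity-check map -/

theorem mulVec_surjective_of_vecMul_eq_zero {ι κ F : Type*} [Fintype ι] [Fintype κ] [Field F]
    {A : Matrix ι κ F} (h : ∀ u, A.vecMul u = 0 → u = 0) (s : ι → F) : ∃ v, A.mulVec v = s := by
  classical
  have hinj : Function.Injective A.transpose.mulVecLin := by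
    rw [← LinearMap.ker_eq_bot, LinearMap.ker_eq_bot']
    intro u hu
    exact h u (by simpa [Matrix.mulVec_transpose] using hu)
  have hr : A.rank = Fintype.card ι := by
    rw [← Matrix.rank_transpose, Matrix.rank, LinearMap.finrank_range_of_inj hinj,
      Module.finrank_fintype_fun_eq_card]
  have ht : LinearMap.range A.mulVecLin = ⊤ := by
    apply Submodule.eq_top_of_finrank_eq
    rw [Module.finrank_fintype_fun_eq_card]
    exact hr
  obtain ⟨v, hv⟩ := LinearMap.range_eq_top.1 ht s
  exact ⟨v, hv⟩

theorem PairBalanced.vecMul_ne {b m : ℕ} {M : Matrix (Fin m) (Fin b) (ZMod 2)}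
    (hM : PairBalanced M) {u : Bits m} (hu : M.vecMul u = 0) : u = 0 := by
  by_contra h
  have := hM u h
  rw [hu, hammingNorm_zero] at this
  omega

theorem PairBalanced.mulVec_surjective {b m : ℕ} {M : Matrix (Fin m) (Fin b) (ZMod 2)}
    (hM : PairBalanced M) (s : Bits m) : ∃ v, M.mulVec v = s :=
  mulVec_surjective_of_vecMul_eq_zero (fun _ => hM.vecMul_ne) s

/-- Adjoining the two coordinate rows at `k` and `l` keeps the rows independent: a nonzero
combination of rows of `M` has weight at least 3, while the new rows only reach two coordinates. The
enlarged matrix is therefore onto. -/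
theorem PairBalanced.exists_ker {b m : ℕ} {M : Matrix (Fin m) (Fin b) (ZMod 2)}
    (hM : PairBalanced M) {k l : Fin b} (hkl : k ≠ l) (α β : ZMod 2) :
    ∃ w, M.mulVec w = 0 ∧ w k = α ∧ w l = β := by
  let B : Matrix (Fin 2) (Fin b) (ZMod 2) := ![Pi.single k 1, Pi.single l 1]
  have hsur : ∀ u, (Matrix.fromRows M B).vecMul u = 0 → u = 0 := by
    intro u hu
    rw [Matrix.vecMul_fromRows] at hu
    have hB : ∀ j, (B.vecMul (u ∘ Sum.inr)) j =
        (if j = k then u (Sum.inr 0) else 0) + (if j = l then u (Sum.inr 1) else 0) := by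
      intro j
      simp [B, Matrix.vecMul, dotProduct, Pi.single_apply]
    have h1 : u ∘ Sum.inl = 0 := by
      by_contra h
      have h3 := hM _ h
      have h4 : hammingNorm (M.vecMul (u ∘ Sum.inl)) ≤ ({k, l} : Finset (Fin b)).card := by
        unfold hammingNorm
        refine Finset.card_le_card fun j hj => ?_
        by_contra hj'
        simp only [Finset.mem_insert, Finset.mem_singleton, not_or] at hj'
        have hj0 := congrFun hu j
        rw [Pi.add_apply, hB j] at hj0
        simp [hj'] at hj0
        exact (Finset.mem_filter.1 hj).2 hj0
      have h5 := Finset.card_le_two (a := k) (b := l)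
      omega
    rw [h1, Matrix.zero_vecMul, zero_add] at hu
    have hk := congrFun hu k
    have hl := congrFun hu l
    rw [hB] at hk hl
    simp [hkl, hkl.symm] at hk hl
    funext j
    rcases j with j | j
    · exact congrFun h1 j
    · fin_cases j
      · exact hk
      · exact hl
  obtain ⟨w, hw⟩ := mulVec_surjective_of_vecMul_eq_zero hsur (Sum.elim 0 ![α, β])
  rw [Matrix.fromRows_mulVec] at hw
  refine ⟨w, ?_, ?_, ?_⟩
  · funext i
    simpa using congrFun hw (Sum.inl i)
  · simpa [B, Matrix.mulVec] using congrFun hw (Sum.inr 0)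
  · simpa [B, Matrix.mulVec] using congrFun hw (Sum.inr 1)

theorem card_fibre_mul_card {G H : Type*} [AddGroup G] [AddGroup H] [Fintype G] [Fintype H]
    [DecidableEq H] (φ : G →+ H) (hφ : Function.Surjective φ) (s : H) :
    (Finset.univ.filter fun v => φ v = s).card * Fintype.card H = Fintype.card G := by
  have h : ∀ t, (Finset.univ.filter fun v => φ v = t).card =
      (Finset.univ.filter fun v => φ v = s).card := fun t =>
    AddMonoidHom.card_fiber_eq_of_mem_range φ (hφ t) (hφ s)
  have h2 := Finset.card_eq_sum_card_fiberwise (s := (Finset.univ : Finset G))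
    (t := Finset.univ) (f := φ) (fun _ _ => Finset.mem_coe.2 (Finset.mem_univ _))
  simp only [h, Finset.sum_const, Finset.card_univ, smul_eq_mul] at h2
  rw [h2, mul_comm]

theorem card_bits (m : ℕ) : Fintype.card (Bits m) = 2 ^ m := by simp [ZMod.card]

theorem card_fibre_mul {b m : ℕ} {M : Matrix (Fin m) (Fin b) (ZMod 2)}
    (hM : PairBalanced M) (s : Bits m) :
    (Finset.univ.filter fun v : Bits b => M.mulVec v = s).card * 2 ^ m = 2 ^ b := by
  have := card_fibre_mul_card M.mulVecLin.toAddMonoidHom hM.mulVec_surjective s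
  rw [card_bits, card_bits] at this
  exact this

/-- Translations by kernel elements preserve `h` and permute the four values of the bit pair
transitively, so the four sums are equal. -/
theorem sum_pair_eq {b m : ℕ} {M : Matrix (Fin m) (Fin b) (ZMod 2)} (hM : PairBalanced M)
    {h : Bits b → ℝ} (hinv : ∀ w, M.mulVec w = 0 → ∀ v, h (v + w) = h v) (hsum : ∑ v, h v = 1)
    {k l : Fin b} (hkl : k ≠ l) (a₁ a₂ : ZMod 2) :
    ∑ v ∈ Finset.univ.filter (fun v : Bits b => v k = a₁ ∧ v l = a₂), h v = 1 / 4 := by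
  set T : ZMod 2 → ZMod 2 → ℝ := fun a c =>
    ∑ v ∈ Finset.univ.filter (fun v : Bits b => v k = a ∧ v l = c), h v
  have hT : ∀ a c, T a c = T a₁ a₂ := by
    intro a c
    obtain ⟨w, hw, hwk, hwl⟩ := hM.exists_ker hkl (a₁ - a) (a₂ - c)
    refine Finset.sum_nbij' (fun v => v + w) (fun v => v - w) ?_ ?_ ?_ ?_ ?_
    · intro v hv
      simp only [Finset.mem_filter, Finset.mem_univ, true_and, Pi.add_apply] at hv ⊢
      rw [hv.1, hv.2, hwk, hwl]
      constructor <;> ring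
    · intro v hv
      simp only [Finset.mem_filter, Finset.mem_univ, true_and, Pi.sub_apply] at hv ⊢
      rw [hv.1, hv.2, hwk, hwl]
      constructor <;> ring
    · intro v _; simp
    · intro v _; simp
    · intro v _; exact (hinv w hw v).symm
  have htot : ∑ a, ∑ c, T a c = 1 := by
    rw [← hsum, ← Fintype.sum_prod_type', ← Finset.sum_fiberwise
      (s := (Finset.univ : Finset (Bits b))) (g := fun v => (v k, v l))]
    refine Finset.sum_congr rfl fun x _ => ?_
    simp only [T, Prod.ext_iff]
  simp only [hT, Finset.sum_const, Finset.card_univ, ZMod.card] at htot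
  change T a₁ a₂ = 1 / 4
  simp at htot
  linarith

theorem sum_bit_eq {b m : ℕ} {M : Matrix (Fin m) (Fin b) (ZMod 2)} (hM : PairBalanced M)
    {h : Bits b → ℝ} (hinv : ∀ w, M.mulVec w = 0 → ∀ v, h (v + w) = h v) (hsum : ∑ v, h v = 1)
    (hb : 2 ≤ b) (k : Fin b) (a : ZMod 2) :
    ∑ v ∈ Finset.univ.filter (fun v : Bits b => v k = a), h v = 1 / 2 := by
  have : Nontrivial (Fin b) := Fin.nontrivial_iff_two_le.2 hb
  obtain ⟨l, hl⟩ := exists_ne k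
  rw [← Finset.sum_fiberwise (g := fun v : Bits b => v l)]
  simp only [Finset.filter_filter, sum_pair_eq hM hinv hsum hl.symm]
  simp
  norm_num

/-! ### Block marginals and their consistency -/

theorem Graph.exists_pos {n N b : ℕ} (G : Graph n N b) {i : Fin n} {l : Fin N}
    (hl : l ∈ G.nbr i) : ∃ k, G.pos i k = l := by
  have : l ∈ Set.range ((G i).1.orderEmbOfFin (G i).2) := by
    rw [Finset.range_orderEmbOfFin]; exact hl
  exact this

theorem Graph.pos_injective {n N b : ℕ} (G : Graph n N b) (i : Fin n) :
    Function.Injective (G.pos i) :=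
  ((G i).1.orderEmbOfFin (G i).2).injective

theorem bitMarginal_eq_pairMarginal {n N b : ℕ} (G : Graph n N b) (φ : BlockVec n b)
    (i : Fin n) (l : Fin N) (a : ZMod 2) :
    bitMarginal G φ i l a = pairMarginal G φ i l l a a := by
  simp [bitMarginal, pairMarginal]

theorem consistent_of_pairMarginal_eq {n N b : ℕ} {G : Graph n N b} {φ : BlockVec n b}
    (F : Fin N → Fin N → ZMod 2 → ZMod 2 → ℝ)
    (h : ∀ i, ∀ l ∈ G.nbr i, ∀ m ∈ G.nbr i, ∀ a₁ a₂, pairMarginal G φ i l m a₁ a₂ = F l m a₁ a₂) :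
    BitConsistent G φ ∧ BitPairConsistent G φ := by
  refine ⟨fun i j _ l hl a => ?_, fun i j _ _ l hl m hm a₁ a₂ => ?_⟩
  · rw [Finset.mem_inter] at hl
    rw [bitMarginal_eq_pairMarginal, bitMarginal_eq_pairMarginal, h i l hl.1 l hl.1,
      h j l hl.2 l hl.2]
  · rw [Finset.mem_inter] at hl hm
    rw [h i l hl.1 m hm.1, h j l hl.2 m hm.2]

theorem distVec_apply {n N b : ℕ} (G : Graph n N b) (P : Bits N → ℝ) (i : Fin n) (v : Bits b) :
    distVec G P i v = ∑ c, if G.view i c = v then P c else 0 := by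
  simp [distVec, codewordVec, Finset.sum_apply]

theorem sum_filter_distVec {n N b : ℕ} (G : Graph n N b) (P : Bits N → ℝ) (i : Fin n)
    (p : Bits b → Prop) [DecidablePred p] :
    ∑ v ∈ Finset.univ.filter p, distVec G P i v = ∑ c, if p (G.view i c) then P c else 0 := by
  simp only [distVec_apply]
  rw [Finset.sum_comm]
  refine Finset.sum_congr rfl fun c _ => ?_
  rw [Finset.sum_ite_eq]
  simp

/-- Each pair marginal is computed directly from the law `P` of the codeword, with no reference to
the block. -/
theorem distVec_consistent {n N b : ℕ} (G : Graph n N b) (P : Bits N → ℝ) :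
    BitConsistent G (distVec G P) ∧ BitPairConsistent G (distVec G P) := by
  refine consistent_of_pairMarginal_eq
    (fun l m a₁ a₂ => ∑ c, if c l = a₁ ∧ c m = a₂ then P c else 0) ?_
  intro i l hl m hm a₁ a₂
  obtain ⟨k, rfl⟩ := G.exists_pos hl
  obtain ⟨k', rfl⟩ := G.exists_pos hm
  unfold pairMarginal
  rw [sum_filter_distVec]
  simp [(G.pos_injective i).eq_iff, Graph.view]

theorem distVec_mem_polytope {n N b : ℕ} (G : Graph n N b) {P : Bits N → ℝ} (h0 : ∀ c, 0 ≤ P c)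
    (h1 : ∑ c, P c = 1) : distVec G P ∈ polytope n b := by
  refine ⟨fun i v => ?_, fun i => ?_⟩
  · rw [distVec_apply]
    exact Finset.sum_nonneg fun c _ => by split_ifs <;> simp [h0]
  · have := sum_filter_distVec G P i (fun _ => True)
    simpa [h1] using this

theorem distVec_mem_generated {n N b : ℕ} (G : Graph n N b) {P : Bits N → ℝ}
    (h0 : ∀ c, 0 ≤ P c) (h1 : ∑ c, P c = 1) : distVec G P ∈ generated G :=
  (convex_convexHull ℝ _).sum_mem (fun c _ => h0 c) h1
    fun c _ => subset_convexHull ℝ _ ⟨c, rfl⟩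

theorem uniformDist_nonneg {N : ℕ} (S : Finset (Bits N)) (c : Bits N) : 0 ≤ uniformDist S c := by
  unfold uniformDist; split_ifs <;> positivity

theorem sum_uniformDist {N : ℕ} {S : Finset (Bits N)} (hS : S.Nonempty) :
    ∑ c, uniformDist S c = 1 := by
  have : (S.card : ℝ) ≠ 0 := by exact_mod_cast hS.card_pos.ne'
  simp [uniformDist, Finset.sum_ite_mem, this]

theorem sum_idealVec {n b : ℕ} {f : LocalMaps n b} {x : Bits n} {i : Fin n}
    (hf : 0 < fibreCard f i (x i)) : ∑ v, idealVec f x i v = 1 := by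
  have : (fibreCard f i (x i) : ℝ) ≠ 0 := by exact_mod_cast hf.ne'
  unfold idealVec
  rw [← Finset.sum_filter, Finset.sum_const, nsmul_eq_mul]
  change (fibreCard f i (x i) : ℝ) * _ = 1
  field_simp

theorem idealVec_mem_polytope {n b : ℕ} {f : LocalMaps n b} {x : Bits n}
    (hf : ∀ i, 0 < fibreCard f i (x i)) : idealVec f x ∈ polytope n b := by
  refine ⟨fun i v => ?_, fun i => sum_idealVec (hf i)⟩
  unfold idealVec; split_ifs <;> positivity

/-- In every block the pair marginals are those of independent fair bits. The diagonal case `l = m`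
is included, and it gives the bit marginals. -/
theorem idealVec_consistent {n N b m K : ℕ} {M : Matrix (Fin m) (Fin b) (ZMod 2)}
    (hM : PairBalanced M) (hb : 2 ≤ b) (G : Graph n N b)
    (A : Fin n → {A : Finset (Bits m) // A.card = K}) (x : Bits n)
    (hf : ∀ i, 0 < fibreCard (decoderMaps M A) i (x i)) :
    BitConsistent G (idealVec (decoderMaps M A) x) ∧
      BitPairConsistent G (idealVec (decoderMaps M A) x) := by
  refine consistent_of_pairMarginal_eq
    (fun l m a₁ a₂ => if l = m then (if a₁ = a₂ then 1 / 2 else 0) else 1 / 4) ?_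
  intro i l hl m hm a₁ a₂
  obtain ⟨k, rfl⟩ := G.exists_pos hl
  obtain ⟨k', rfl⟩ := G.exists_pos hm
  have hinv : ∀ w, M.mulVec w = 0 → ∀ v, idealVec (decoderMaps M A) x i (v + w) =
      idealVec (decoderMaps M A) x i v := by
    intro w hw v
    simp [idealVec, decoderMaps, Matrix.mulVec_add, hw]
  have hs := sum_idealVec (hf i)
  unfold pairMarginal
  simp only [(G.pos_injective i).eq_iff, forall_eq]
  by_cases hk : k = k'
  · subst hk
    by_cases ha : a₁ = a₂
    · subst ha
      simpa using sum_bit_eq hM hinv hs hb k a₁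
    · have : ∀ v : Bits b, ¬ (v k = a₁ ∧ v k = a₂) := fun v hv => ha (hv.1.symm.trans hv.2)
      simp [this, ha]
  · simpa [hk] using sum_pair_eq hM hinv hs hk a₁ a₂

/-! ### From ℓ¹-regular cylinder sizes to an eligible perturbation -/

section

section Block
variable {V : Type*} [Fintype V]

/-- Replacing the total `F * μ` by the true total at most doubles the ℓ¹ error, and the true total
is at least half of `F * μ`; hence the factor 4. -/
theorem sum_abs_div_sub_le {Z : V → ℝ} {p : V → Prop} [DecidablePred p] {μ ξ : ℝ}
    (hp : 0 < (Finset.univ.filter p).card) (hμ : 0 < μ) (hξ : ξ ≤ 1 / 2)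
    (h : ∑ v, |Z v - if p v then μ else 0| ≤ ξ * ((Finset.univ.filter p).card * μ)) :
    0 < ∑ v, Z v ∧
      ∑ v, |Z v / (∑ v, Z v) - if p v then 1 / ((Finset.univ.filter p).card : ℝ) else 0| ≤
        4 * ξ := by
  set F : ℝ := ((Finset.univ.filter p).card : ℝ)
  have hF : 0 < F := by simpa [F] using hp
  set C := ∑ v, Z v
  have hsum : ∑ v, (if p v then μ else 0) = F * μ := by
    rw [← Finset.sum_filter, Finset.sum_const, nsmul_eq_mul]
  have hC : |C - F * μ| ≤ ξ * (F * μ) := by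
    rw [← hsum, ← Finset.sum_sub_distrib]
    refine (Finset.abs_sum_le_sum_abs _ _).trans ?_
    rw [hsum]; exact h
  have hFμ : 0 < F * μ := by positivity
  have hC2 : F * μ / 2 ≤ C := by
    have := (abs_le.1 hC).1
    nlinarith
  have hC0 : 0 < C := by linarith
  refine ⟨hC0, ?_⟩
  have hterm : ∀ v, |Z v / C - if p v then 1 / F else 0| ≤
      (|Z v - if p v then μ else 0| + if p v then |C - F * μ| / F else 0) / C := by
    intro v
    by_cases hv : p v
    · simp only [hv, if_true]
      have : Z v / C - 1 / F = ((Z v - μ) - (C - F * μ) / F) / C := by field_simp; ring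
      rw [this, abs_div, abs_of_pos hC0]
      gcongr
      refine (abs_sub _ _).trans ?_
      rw [abs_div, abs_of_pos hF]
    · simp only [hv, if_false, sub_zero, add_zero]
      rw [abs_div, abs_of_pos hC0]
  refine (Finset.sum_le_sum fun v _ => hterm v).trans ?_
  rw [← Finset.sum_div, Finset.sum_add_distrib, ← Finset.sum_filter (p := p), Finset.sum_const,
    nsmul_eq_mul]
  change (_ + F * (|C - F * μ| / F)) / C ≤ _
  rw [mul_div_cancel₀ _ hF.ne', div_le_iff₀ hC0]
  have hξ0 : 0 ≤ ξ := by
    by_contra hneg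
    have := (abs_nonneg _).trans hC
    nlinarith
  nlinarith

/-- Where u exceeds a + τ, the excess u - a is part of the ℓ¹ error, and u is at most 1 + a/τ times
that excess. This bounds the mass of the bad cylinders. -/
theorem sum_large_le {u e : V → ℝ} {a τ δ : ℝ} (ha : 0 ≤ a) (hτ : 0 < τ) (he : ∀ v, e v ≤ a)
    (h : ∑ v, |u v - e v| ≤ δ) :
    ∑ v ∈ Finset.univ.filter (fun v => a + τ < u v), u v ≤ δ * (1 + a / τ) := by
  have hc : 0 ≤ 1 + a / τ := by positivity
  calc ∑ v ∈ Finset.univ.filter (fun v => a + τ < u v), u v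
      ≤ ∑ v ∈ Finset.univ.filter (fun v => a + τ < u v), |u v - e v| * (1 + a / τ) := by
        refine Finset.sum_le_sum fun v hv => ?_
        have hv' := (Finset.mem_filter.1 hv).2
        have h1 : u v - a ≤ |u v - e v| := le_trans (by linarith [he v]) (le_abs_self _)
        have h2 : a ≤ (u v - a) * (a / τ) := by
          rw [mul_div_assoc', le_div_iff₀ hτ]
          nlinarith
        calc u v ≤ (u v - a) * (1 + a / τ) := by linarith
          _ ≤ _ := mul_le_mul_of_nonneg_right h1 hc
    _ ≤ ∑ v, |u v - e v| * (1 + a / τ) :=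
        Finset.sum_le_sum_of_subset_of_nonneg (Finset.subset_univ _) fun v _ _ => by positivity
    _ ≤ _ := by rw [← Finset.sum_mul]; gcongr

end Block

variable {n N b : ℕ}

theorem sum_card_cylinder (G : Graph n N b) (f : LocalMaps n b) (x : Bits n) (i : Fin n) :
    ∑ v, ((cylinder G f x i v).card : ℝ) = (validCodewords G f x).card := by
  have := Finset.card_eq_sum_card_fiberwise (s := validCodewords G f x)
    (t := Finset.univ) (f := fun c => G.view i c) (fun _ _ => Finset.mem_coe.2 (Finset.mem_univ _))
  rw [this]
  push_cast
  rfl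

theorem cylinder_eq_empty {G : Graph n N b} {f : LocalMaps n b} {x : Bits n} {i : Fin n}
    {v : Bits b} (h : f i v ≠ x i) : cylinder G f x i v = ∅ := by
  unfold cylinder validCodewords
  rw [Finset.filter_filter, Finset.filter_eq_empty_iff]
  rintro c - ⟨hc, rfl⟩
  exact h (hc i)

theorem distVec_uniformDist (G : Graph n N b) (S : Finset (Bits N)) (i : Fin n) (v : Bits b) :
    distVec G (uniformDist S) i v = ((S.filter fun c => G.view i c = v).card : ℝ) / S.card := by
  rw [distVec_apply]
  unfold uniformDist
  simp only [← ite_and]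
  rw [← Finset.sum_filter, Finset.sum_const, nsmul_eq_mul, mul_one_div]
  congr 3
  ext c
  simp [and_comm]

theorem card_sdiff_expurgated_le (G : Graph n N b) (f : LocalMaps n b) (x : Bits n) {τ β : ℝ}
    (h : ∀ i, ∑ v ∈ Finset.univ.filter (fun v => 1 / (fibreCard f i (x i) : ℝ) + τ <
      ((cylinder G f x i v).card : ℝ) / (validCodewords G f x).card),
      ((cylinder G f x i v).card : ℝ) / (validCodewords G f x).card ≤ β) :
    ((validCodewords G f x).card : ℝ) - (expurgated G f x τ).card ≤
      n * β * (validCodewords G f x).card := by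
  classical
  set C : ℝ := ((validCodewords G f x).card : ℝ)
  rcases Nat.eq_zero_or_pos (validCodewords G f x).card with h0 | h0
  · have : C = 0 := by simp [C, h0]
    rw [this]; simp
  have hC : 0 < C := Nat.cast_pos.2 h0
  set bad : Fin n → Finset (Bits b) := fun i => Finset.univ.filter fun v =>
    1 / (fibreCard f i (x i) : ℝ) + τ < ((cylinder G f x i v).card : ℝ) / C
  have hsub : validCodewords G f x ⊆ expurgated G f x τ ∪
      Finset.univ.biUnion fun i => (bad i).biUnion fun v => cylinder G f x i v := by
    intro c hc
    by_cases hc' : c ∈ expurgated G f x τ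
    · exact Finset.mem_union_left _ hc'
    · refine Finset.mem_union_right _ ?_
      have : ∃ i, BadCylinder G f x τ i (G.view i c) := by
        by_contra hne
        push Not at hne
        exact hc' (Finset.mem_filter.2 ⟨hc, hne⟩)
      obtain ⟨i, hi⟩ := this
      refine Finset.mem_biUnion.2 ⟨i, Finset.mem_univ _, Finset.mem_biUnion.2
        ⟨G.view i c, Finset.mem_filter.2 ⟨Finset.mem_univ _, hi⟩, ?_⟩⟩
      exact Finset.mem_filter.2 ⟨hc, rfl⟩
  have hcard : (validCodewords G f x).card ≤ (expurgated G f x τ).card +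
      ∑ i, ∑ v ∈ bad i, (cylinder G f x i v).card := by
    refine (Finset.card_le_card hsub).trans ((Finset.card_union_le _ _).trans ?_)
    gcongr
    refine Finset.card_biUnion_le.trans ?_
    gcongr with i
    exact Finset.card_biUnion_le
  have hcard' : C ≤ (expurgated G f x τ).card +
      ∑ i, ∑ v ∈ bad i, ((cylinder G f x i v).card : ℝ) := by
    simp only [C]
    exact_mod_cast hcard
  have hi : ∀ i, ∑ v ∈ bad i, ((cylinder G f x i v).card : ℝ) ≤ β * C := by
    intro i
    have := h i
    rw [← Finset.sum_div, div_le_iff₀ hC] at this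
    exact this
  have : ∑ i, ∑ v ∈ bad i, ((cylinder G f x i v).card : ℝ) ≤ ∑ _i : Fin n, β * C :=
    Finset.sum_le_sum fun i _ => hi i
  simp only [Finset.sum_const, Finset.card_univ, Fintype.card_fin, nsmul_eq_mul] at this
  nlinarith

theorem expurgated_subset (G : Graph n N b) (f : LocalMaps n b) (x : Bits n) (τ : ℝ) :
    expurgated G f x τ ⊆ validCodewords G f x := by
  classical
  exact Finset.filter_subset _ _

theorem not_badCylinder_of_mem {G : Graph n N b} {f : LocalMaps n b} {x : Bits n} {τ : ℝ}
    {c : Bits N} (hc : c ∈ expurgated G f x τ) (i : Fin n) :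
    ¬ BadCylinder G f x τ i (G.view i c) := by
  classical
  exact (Finset.mem_filter.1 hc).2 i

/-- The block marginals of a large subset of the valid codewords are close to those of all valid
codewords. -/
theorem sum_abs_distVec_sub_le (G : Graph n N b) (f : LocalMaps n b) (x : Bits n) (i : Fin n)
    {S : Finset (Bits N)} (hS : S ⊆ validCodewords G f x) (hne : S.Nonempty) {ζ : ℝ}
    (hζ : ((validCodewords G f x).card : ℝ) - S.card ≤ ζ * (validCodewords G f x).card) :
    ∑ v, |distVec G (uniformDist S) i v -
      ((cylinder G f x i v).card : ℝ) / (validCodewords G f x).card| ≤ 2 * ζ := by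
  set C : ℝ := ((validCodewords G f x).card : ℝ)
  have hs : (0 : ℝ) < S.card := by exact_mod_cast hne.card_pos
  have hsC : (S.card : ℝ) ≤ C := Nat.cast_le.2 (Finset.card_le_card hS)
  have hC : 0 < C := by linarith
  set Z : Bits b → ℝ := fun v => (cylinder G f x i v).card
  set Z' : Bits b → ℝ := fun v => (S.filter fun c => G.view i c = v).card
  have hZ : ∑ v, Z v = C := sum_card_cylinder G f x i
  have hZ' : ∑ v, Z' v = S.card := by
    have := Finset.card_eq_sum_card_fiberwise (s := S)
      (t := Finset.univ) (f := fun c => G.view i c)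
      (fun _ _ => Finset.mem_coe.2 (Finset.mem_univ _))
    rw [this]; push_cast; rfl
  have hle : ∀ v, Z' v ≤ Z v := fun v => by
    have : (S.filter fun c => G.view i c = v) ⊆ cylinder G f x i v :=
      Finset.filter_subset_filter _ hS
    exact Nat.cast_le.2 (Finset.card_le_card this)
  -- The two terms are the deleted mass and the renormalisation; each sums to the deleted fraction.
  have hterm : ∀ v, |distVec G (uniformDist S) i v - Z v / C| ≤
      (Z v - Z' v) / C + Z' v * (1 / S.card - 1 / C) := by
    intro v
    rw [distVec_uniformDist]
    change |Z' v / _ - _| ≤ _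
    have e : Z' v / S.card - Z v / C = -((Z v - Z' v) / C) + Z' v * (1 / S.card - 1 / C) := by
      ring
    have h1 : 0 ≤ (Z v - Z' v) / C := div_nonneg (by linarith [hle v]) hC.le
    have h2 : 0 ≤ Z' v * (1 / S.card - 1 / C) := by
      refine mul_nonneg (Nat.cast_nonneg _) (sub_nonneg.2 ?_)
      exact one_div_le_one_div_of_le hs hsC
    rw [e, abs_le]
    constructor <;> linarith
  refine (Finset.sum_le_sum fun v _ => hterm v).trans ?_
  rw [Finset.sum_add_distrib, ← Finset.sum_div, Finset.sum_sub_distrib, ← Finset.sum_mul, hZ, hZ']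
  have e : (C - S.card) / C + S.card * (1 / S.card - 1 / C) = 2 * ((C - S.card) / C) := by
    field_simp; ring
  rw [e]
  have : (C - S.card) / C ≤ ζ := by rwa [div_le_iff₀ hC]
  linarith

/-- If all cylinder sizes are close in `ℓ¹` to their expectations, the expurgated uniform
distribution is an eligible perturbation of the ideal vector. -/
theorem exists_eligible_of_near {m K : ℕ} {M : Matrix (Fin m) (Fin b) (ZMod 2)}
    (hM : PairBalanced M) (hb : 2 ≤ b) (hn : 2 ≤ n) (G : Graph n N b)
    (A : Fin n → {A : Finset (Bits m) // A.card = K}) (x : Bits n) {ρ ξ : ℝ} {μ : Fin n → ℝ}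
    (hρ : 0 < ρ) (hF : ∀ i, ρ * 2 ^ b ≤ fibreCard (decoderMaps M A) i (x i))
    (hμ : ∀ i, 0 < μ i) (hξ0 : 0 ≤ ξ)
    (hξ : 4 * n * ξ * (1 + n ^ 4 / ρ) ≤ 1 / (4 * (n : ℝ) ^ 4))
    (hnear : ∀ i, ∑ v, |((cylinder G (decoderMaps M A) x i v).card : ℝ) -
      if decoderMaps M A i v = x i then μ i else 0| ≤
        ξ * (fibreCard (decoderMaps M A) i (x i) * μ i)) :
    ∃ η ∈ eligible G (decoderMaps M A) x,
      idealVec (decoderMaps M A) x + η ∈ generated G ∧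
      ∃ τ : ℝ, 0 < τ ∧ τ ≤ 1 / ((n : ℝ) * 2 ^ b) ∧
        (expurgated G (decoderMaps M A) x τ).Nonempty ∧
        idealVec (decoderMaps M A) x + η =
          distVec G (uniformDist (expurgated G (decoderMaps M A) x τ)) := by
  set f := decoderMaps M A
  have hn' : (2 : ℝ) ≤ n := by exact_mod_cast hn
  have hF0 : ∀ i, 0 < fibreCard f i (x i) := fun i => by
    have : (0 : ℝ) < fibreCard f i (x i) := lt_of_lt_of_le (by positivity) (hF i)
    exact_mod_cast this
  have hFle : ∀ i, (fibreCard f i (x i) : ℝ) ≤ 2 ^ b := fun i => by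
    have : fibreCard f i (x i) ≤ 2 ^ b := by
      refine (Finset.card_le_univ _).trans (le_of_eq ?_)
      simp [ZMod.card]
    exact_mod_cast this
  -- Bounds the expurgated fraction: a union over `n` blocks, each losing at most the amount given
  -- by `sum_large_le` with a/τ ≤ n⁴/ρ.
  set ζ : ℝ := n * (4 * ξ * (1 + n ^ 4 / ρ)) with hζdef
  have hζ : ζ ≤ 1 / (4 * (n : ℝ) ^ 4) := by
    refine le_trans (le_of_eq ?_) hξ; rw [hζdef]; ring
  have hζ4 : 4 * ξ ≤ ζ := by
    have h1 : 4 * ξ ≤ 4 * ξ * (1 + n ^ 4 / ρ) :=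
      le_mul_of_one_le_right (by positivity) (by simp only [le_add_iff_nonneg_right]; positivity)
    have h2 : 4 * ξ * (1 + n ^ 4 / ρ) ≤ ζ :=
      le_mul_of_one_le_left (by positivity) (by linarith)
    linarith
  set y : ℝ := 1 / (n : ℝ) ^ 2
  have hy0 : 0 < y := by positivity
  have hy : y ≤ 1 / 4 := by
    refine one_div_le_one_div_of_le (by norm_num) ?_
    nlinarith
  have hy4 : 1 / (n : ℝ) ^ 4 = y ^ 2 := by simp only [y]; field_simp
  have hζy : ζ ≤ y ^ 2 / 4 := by
    refine hζ.trans (le_of_eq ?_)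
    rw [← hy4]; field_simp
  have hξ2 : ξ ≤ 1 / 2 := by nlinarith
  -- Small enough that τ costs only a relative n⁻⁴ on top of 1/F, against the permitted n⁻².
  set τ : ℝ := 1 / ((n : ℝ) ^ 4 * 2 ^ b)
  have hτ : 0 < τ := by positivity
  have hblock : ∀ i, 0 < ((validCodewords G f x).card : ℝ) ∧
      ∑ v, |((cylinder G f x i v).card : ℝ) / (validCodewords G f x).card - idealVec f x i v| ≤
        4 * ξ := by
    intro i
    have h := sum_abs_div_sub_le (p := fun v => f i v = x i) (hF0 i) (hμ i) hξ2 (hnear i)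
    rw [sum_card_cylinder] at h
    exact h
  have hC : 0 < ((validCodewords G f x).card : ℝ) := (hblock ⟨0, by omega⟩).1
  have hideal : ∀ i v, idealVec f x i v ≤ 1 / (fibreCard f i (x i) : ℝ) := by
    intro i v; unfold idealVec; split_ifs
    · exact le_rfl
    · positivity
  have hexp : ((validCodewords G f x).card : ℝ) - (expurgated G f x τ).card ≤
      ζ * (validCodewords G f x).card := by
    refine card_sdiff_expurgated_le G f x fun i => ?_
    refine (sum_large_le (by positivity) hτ (hideal i) (hblock i).2).trans ?_
    have : 1 / (fibreCard f i (x i) : ℝ) / τ ≤ n ^ 4 / ρ := by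
      have hFi : (0 : ℝ) < fibreCard f i (x i) := by exact_mod_cast hF0 i
      simp only [τ]
      rw [div_div_eq_mul_div, div_one, one_div_mul_eq_div, div_le_div_iff₀ hFi hρ]
      have := hF i
      calc (n : ℝ) ^ 4 * 2 ^ b * ρ = n ^ 4 * (ρ * 2 ^ b) := by ring
        _ ≤ _ := by gcongr
    gcongr
  set S := expurgated G f x τ with hSdef
  have hSC : (1 - ζ) * (validCodewords G f x).card ≤ S.card := by linarith
  have hζ1 : ζ ≤ 1 / 64 := by nlinarith
  have hScard : (0 : ℝ) < S.card := lt_of_lt_of_le (mul_pos (by linarith) hC) hSC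
  have hSne : S.Nonempty := Finset.card_pos.1 (by exact_mod_cast hScard)
  have hSsub : S ⊆ validCodewords G f x := expurgated_subset G f x τ
  have heq : idealVec f x + (distVec G (uniformDist S) - idealVec f x) =
      distVec G (uniformDist S) := add_sub_cancel _ _
  refine ⟨distVec G (uniformDist S) - idealVec f x, ⟨?_, ?_, ?_⟩, ?_, τ, hτ, ?_, hSne, heq⟩
  · have h1 := distVec_consistent G (uniformDist S)
    have h2 := idealVec_consistent hM hb G A x hF0
    exact ⟨_, distVec_mem_polytope G (uniformDist_nonneg S) (sum_uniformDist hSne), _,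
      idealVec_mem_polytope hF0, h1.1, h1.2, h2.1, h2.2, rfl⟩
  -- A pair marginal is a partial sum of one block, so the ℓ¹ norm of that block controls it.
  · intro i _ _ l _ m _ a₁ a₂
    unfold pairMarginal
    refine (Finset.abs_sum_le_sum_abs _ _).trans ?_
    refine (Finset.sum_le_sum_of_subset_of_nonneg (Finset.subset_univ _)
      fun v _ _ => abs_nonneg _).trans ?_
    have h1 := sum_abs_distVec_sub_le G f x i hSsub hSne hexp
    calc ∑ v, |(distVec G (uniformDist S) - idealVec f x) i v|
        ≤ ∑ v, (|distVec G (uniformDist S) i v -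
            ((cylinder G f x i v).card : ℝ) / (validCodewords G f x).card| +
          |((cylinder G f x i v).card : ℝ) / (validCodewords G f x).card -
            idealVec f x i v|) := Finset.sum_le_sum fun v _ => abs_sub_le _ _ _
      _ ≤ 2 * ζ + 4 * ξ := by
          rw [Finset.sum_add_distrib]
          exact add_le_add h1 (hblock i).2
      _ ≤ _ := by rw [hy4]; nlinarith
  · intro i v
    have hFi : (0 : ℝ) < fibreCard f i (x i) := by exact_mod_cast hF0 i
    rw [Pi.sub_apply, Pi.sub_apply, distVec_uniformDist]
    have hrhs : 0 ≤ 1 / ((n : ℝ) ^ 2 * (fibreCard f i (x i) : ℝ)) := by positivity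
    have hid0 : 0 ≤ idealVec f x i v := (idealVec_mem_polytope hF0).1 i v
    by_cases hz : (S.filter fun c => G.view i c = v) = ∅
    · rw [hz]; simp only [Finset.card_empty, Nat.cast_zero, zero_div]; linarith
    · obtain ⟨c, hc⟩ := Finset.nonempty_iff_ne_empty.2 hz
      obtain ⟨hcS, rfl⟩ := Finset.mem_filter.1 hc
      have hgood : ¬ BadCylinder G f x τ i (G.view i c) :=
        not_badCylinder_of_mem (hSdef ▸ hcS) i
      have hfx : f i (G.view i c) = x i := (Finset.mem_filter.1 (hSsub hcS)).2 i
      have hid : idealVec f x i (G.view i c) = 1 / (fibreCard f i (x i) : ℝ) := by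
        simp [idealVec, hfx]
      rw [hid]
      unfold BadCylinder at hgood
      rw [not_lt, div_le_iff₀ hC] at hgood
      have hle : ((S.filter fun c' => G.view i c' = G.view i c).card : ℝ) ≤
          (cylinder G f x i (G.view i c)).card := by
        exact_mod_cast Finset.card_le_card (Finset.filter_subset_filter _ hSsub)
      set F : ℝ := (fibreCard f i (x i) : ℝ)
      have hτF : τ ≤ y ^ 2 / F := by
        rw [← hy4, div_div]
        refine one_div_le_one_div_of_le (by positivity) ?_
        have := hFle i
        gcongr
      -- A surviving cylinder holds at most 1/F + τ of the valid codewords. Renormalising to `S`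
      -- divides by at least 1 - ζ, and the slack y = n⁻² absorbs both losses.
      have key : 1 / F + τ ≤ (1 - ζ) * ((1 + y) / F) := by
        have h1 : (1 + y ^ 2) / F ≤ (1 - ζ) * (1 + y) / F := by
          gcongr
          nlinarith
        calc 1 / F + τ ≤ 1 / F + y ^ 2 / F := by gcongr
          _ = (1 + y ^ 2) / F := by ring
          _ ≤ _ := h1
          _ = _ := by ring
      have hy1 : 1 / ((n : ℝ) ^ 2 * F) = y / F := by simp only [y]; field_simp
      rw [hy1, sub_le_iff_le_add, div_le_iff₀ hScard]
      calc ((S.filter fun c' => G.view i c' = G.view i c).card : ℝ)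
          ≤ (1 / F + τ) * (validCodewords G f x).card := hle.trans hgood
        _ ≤ ((1 - ζ) * ((1 + y) / F)) * (validCodewords G f x).card := by gcongr
        _ = ((1 + y) / F) * ((1 - ζ) * (validCodewords G f x).card) := by ring
        _ ≤ ((1 + y) / F) * S.card := by gcongr
        _ = _ := by ring
  · rw [heq]
    exact distVec_mem_generated G (uniformDist_nonneg S) (sum_uniformDist hSne)
  · refine one_div_le_one_div_of_le (by positivity) ?_
    gcongr
    exact le_self_pow₀ (by linarith) (by norm_num)

end

/-! ### Random sets and the law of a single block -/

section

section RandomSet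
variable {V : Type*} [Fintype V] {K : ℕ}

theorem sum_sets_perm (σ : Equiv.Perm V) (F : Finset V → ℝ) :
    ∑ A : {A : Finset V // A.card = K}, F (A.1.map σ.toEmbedding) =
      ∑ A : {A : Finset V // A.card = K}, F A.1 :=
  Fintype.sum_equiv (σ.finsetCongr.subtypeEquiv fun A => by simp) _ _ fun _ => rfl

/-- By transposition symmetry the sum does not depend on `s`; summing over all elements counts each
set `K` times. -/
theorem sum_sets_mem [DecidableEq V] (s : V) :
    (Fintype.card V : ℝ) * ∑ A : {A : Finset V // A.card = K}, (if s ∈ A.1 then (1 : ℝ) else 0) =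
      K * Fintype.card {A : Finset V // A.card = K} := by
  have hsym : ∀ t, ∑ A : {A : Finset V // A.card = K}, (if t ∈ A.1 then (1 : ℝ) else 0) =
      ∑ A : {A : Finset V // A.card = K}, (if s ∈ A.1 then (1 : ℝ) else 0) := by
    intro t
    refine (sum_sets_perm (Equiv.swap s t) (fun A => if t ∈ A then (1 : ℝ) else 0)).symm.trans ?_
    refine Finset.sum_congr rfl fun A _ => ?_
    congr 1
    rw [Finset.mem_map_equiv, Equiv.symm_swap, Equiv.swap_apply_right]
  calc _ = ∑ t : V, ∑ A : {A : Finset V // A.card = K}, (if t ∈ A.1 then (1 : ℝ) else 0) := by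
        simp only [hsym, Finset.sum_const, Finset.card_univ, nsmul_eq_mul]
    _ = ∑ A : {A : Finset V // A.card = K}, (K : ℝ) := by
        rw [Finset.sum_comm]
        refine Finset.sum_congr rfl fun A _ => ?_
        simp [A.2]
    _ = _ := by simp [mul_comm]

/-- The same double count, over the second element with `s` held fixed. -/
theorem sum_sets_mem_mem [DecidableEq V] {s t : V} (hst : s ≠ t) :
    ((Fintype.card V : ℝ) - 1) * ∑ A : {A : Finset V // A.card = K},
      (if s ∈ A.1 ∧ t ∈ A.1 then (1 : ℝ) else 0) =
      (K - 1) * ∑ A : {A : Finset V // A.card = K}, (if s ∈ A.1 then (1 : ℝ) else 0) := by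
  have hsym : ∀ u ∈ Finset.univ.erase s, ∑ A : {A : Finset V // A.card = K},
      (if s ∈ A.1 ∧ u ∈ A.1 then (1 : ℝ) else 0) =
      ∑ A : {A : Finset V // A.card = K}, (if s ∈ A.1 ∧ t ∈ A.1 then (1 : ℝ) else 0) := by
    intro u hu
    have hu' := Finset.ne_of_mem_erase hu
    refine (sum_sets_perm (Equiv.swap t u)
      (fun A => if s ∈ A ∧ u ∈ A then (1 : ℝ) else 0)).symm.trans ?_
    refine Finset.sum_congr rfl fun A _ => ?_
    congr 1
    rw [Finset.mem_map_equiv, Finset.mem_map_equiv, Equiv.symm_swap, Equiv.swap_apply_right,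
      Equiv.swap_apply_of_ne_of_ne hst hu'.symm]
  have hcard : ((Finset.univ.erase s).card : ℝ) = (Fintype.card V : ℝ) - 1 := by
    rw [Finset.card_erase_of_mem (Finset.mem_univ _), Finset.card_univ,
      Nat.cast_sub (Fintype.card_pos_iff.2 ⟨s⟩), Nat.cast_one]
  calc _ = ∑ u ∈ Finset.univ.erase s, ∑ A : {A : Finset V // A.card = K},
        (if s ∈ A.1 ∧ u ∈ A.1 then (1 : ℝ) else 0) := by
        rw [Finset.sum_congr rfl hsym, Finset.sum_const, nsmul_eq_mul, hcard]
    _ = ∑ A : {A : Finset V // A.card = K}, (K - 1) * (if s ∈ A.1 then (1 : ℝ) else 0) := by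
        rw [Finset.sum_comm]
        refine Finset.sum_congr rfl fun A _ => ?_
        by_cases hs : s ∈ A.1
        · have h1 := Finset.add_sum_erase Finset.univ
            (fun u => if u ∈ A.1 then (1 : ℝ) else 0) (Finset.mem_univ s)
          simp only [hs, true_and, if_true] at h1 ⊢
          have h2 : ∑ u, (if u ∈ A.1 then (1 : ℝ) else 0) = K := by simp [A.2]
          linarith
        · simp [hs]
    _ = _ := by rw [Finset.mul_sum]

end RandomSet

/-- The value at `s` of the indicator function of `A`. -/
def indBit {m : ℕ} (A : Finset (Bits m)) (s : Bits m) : ZMod 2 := if s ∈ A then 1 else 0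

/-- The probability that a local decoding function takes the value `y`. -/
def bitProb (K m : ℕ) (y : ZMod 2) : ℝ := if y = 1 then K / 2 ^ m else 1 - K / 2 ^ m

theorem zmod_two_cases (y : ZMod 2) : y = 0 ∨ y = 1 := by
  revert y; decide

theorem sum_indBit {m K : ℕ} (s : Bits m) (y : ZMod 2) :
    ∑ A : {A : Finset (Bits m) // A.card = K}, (if indBit A.1 s = y then (1 : ℝ) else 0) =
      Fintype.card {A : Finset (Bits m) // A.card = K} * bitProb K m y := by
  have h := sum_sets_mem (K := K) s
  rw [card_bits] at h
  push_cast at h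
  have h1 : ∑ A : {A : Finset (Bits m) // A.card = K}, (if s ∈ A.1 then (1 : ℝ) else 0) =
      Fintype.card {A : Finset (Bits m) // A.card = K} * (K / 2 ^ m) := by
    field_simp
    linarith
  rcases zmod_two_cases y with rfl | rfl
  · have : ∀ A : {A : Finset (Bits m) // A.card = K},
        (if indBit A.1 s = 0 then (1 : ℝ) else 0) = 1 - if s ∈ A.1 then (1 : ℝ) else 0 := by
      intro A; by_cases hs : s ∈ A.1 <;> simp [indBit, hs]
    simp only [this, Finset.sum_sub_distrib, h1]
    simp [bitProb]
    ring
  · have : ∀ A : {A : Finset (Bits m) // A.card = K},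
        (if indBit A.1 s = 1 then (1 : ℝ) else 0) = if s ∈ A.1 then (1 : ℝ) else 0 := by
      intro A; by_cases hs : s ∈ A.1 <;> simp [indBit, hs]
    simp only [this, h1]
    simp [bitProb]

/-- Sampling without replacement is negatively correlated: K(K-1)/(T(T-1)) ≤ (K/T)² with T = 2ᵐ. For
`y = 0`, inclusion-exclusion shows that the covariance is the same. -/
theorem sum_indBit_pair_le {m K : ℕ} (hK : K ≤ 2 ^ m) {s t : Bits m} (hst : s ≠ t) (y : ZMod 2) :
    ∑ A : {A : Finset (Bits m) // A.card = K},
      (if indBit A.1 s = y ∧ indBit A.1 t = y then (1 : ℝ) else 0) ≤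
      Fintype.card {A : Finset (Bits m) // A.card = K} * bitProb K m y ^ 2 := by
  have h := sum_sets_mem_mem (K := K) hst
  have h1s := sum_indBit (K := K) s 1
  have h1t := sum_indBit (K := K) t 1
  have e1 : ∀ (u : Bits m) (A : {A : Finset (Bits m) // A.card = K}),
      (if indBit A.1 u = 1 then (1 : ℝ) else 0) = if u ∈ A.1 then (1 : ℝ) else 0 := by
    intro u A; by_cases hs : u ∈ A.1 <;> simp [indBit, hs]
  simp only [e1] at h1s h1t
  rw [h1s, card_bits] at h
  push_cast at h
  set D : ℝ := (Fintype.card {A : Finset (Bits m) // A.card = K} : ℝ)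
  have hD : 0 ≤ D := Nat.cast_nonneg _
  set S := ∑ A : {A : Finset (Bits m) // A.card = K}, (if s ∈ A.1 ∧ t ∈ A.1 then (1 : ℝ) else 0)
  have hT : (1 : ℝ) < 2 ^ m := by
    have : 1 < Fintype.card (Bits m) := Fintype.one_lt_card_iff.2 ⟨s, t, hst⟩
    rw [card_bits] at this
    exact_mod_cast this
  have hK' : (K : ℝ) ≤ 2 ^ m := by exact_mod_cast hK
  set r : ℝ := K / 2 ^ m
  have hr0 : 0 ≤ r := by positivity
  have hb1 : bitProb K m 1 = r := by simp [bitProb, r]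
  rw [hb1] at h h1s h1t
  have hKr : (K : ℝ) = r * 2 ^ m := by simp only [r]; field_simp
  have hr1 : r ≤ 1 := by rw [div_le_one (by positivity)]; exact hK'
  have hS : S ≤ D * r ^ 2 := by
    have h2 : (2 ^ m - 1) * S ≤ (2 ^ m - 1) * (D * r ^ 2) := by
      rw [h, hKr]
      have : 0 ≤ D * r * (1 - r) := by
        have : 0 ≤ 1 - r := by linarith
        positivity
      nlinarith
    exact le_of_mul_le_mul_left h2 (by linarith)
  rcases zmod_two_cases y with rfl | rfl
  · have : ∀ A : {A : Finset (Bits m) // A.card = K},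
        (if indBit A.1 s = 0 ∧ indBit A.1 t = 0 then (1 : ℝ) else 0) =
          1 - (if s ∈ A.1 then (1 : ℝ) else 0) - (if t ∈ A.1 then (1 : ℝ) else 0) +
            if s ∈ A.1 ∧ t ∈ A.1 then (1 : ℝ) else 0 := by
      intro A
      by_cases hs : s ∈ A.1 <;> by_cases ht : t ∈ A.1 <;> simp [indBit, hs, ht]
    simp only [this, Finset.sum_add_distrib, Finset.sum_sub_distrib, h1s, h1t]
    have hb0 : bitProb K m 0 = 1 - r := by simp [bitProb, r]
    rw [hb0, Finset.sum_const, Finset.card_univ, nsmul_eq_mul, mul_one]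
    change D - D * r - D * r + S ≤ _
    nlinarith
  · have : ∀ A : {A : Finset (Bits m) // A.card = K},
        (if indBit A.1 s = 1 ∧ indBit A.1 t = 1 then (1 : ℝ) else 0) =
          if s ∈ A.1 ∧ t ∈ A.1 then (1 : ℝ) else 0 := by
      intro A
      by_cases hs : s ∈ A.1 <;> by_cases ht : t ∈ A.1 <;> simp [indBit, hs, ht]
    simp only [this, hb1]
    exact hS

/-- The restriction of `c` to the set `I`, listed in increasing order. -/
def restr {N b : ℕ} (I : {s : Finset (Fin N) // s.card = b}) (c : Bits N) : Bits b :=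
  fun k => c (I.1.orderEmbOfFin I.2 k)

theorem restr_sub {N b : ℕ} (I : {s : Finset (Fin N) // s.card = b}) (c c' : Bits N) :
    restr I (c - c') = restr I c - restr I c' := rfl

theorem card_restr_eq_mul {N b : ℕ} (I : {s : Finset (Fin N) // s.card = b}) (v : Bits b) :
    (Finset.univ.filter fun d : Bits N => restr I d = v).card * 2 ^ b = 2 ^ N := by
  have := card_fibre_mul_card
    ({ toFun := restr I, map_zero' := rfl, map_add' := fun _ _ => rfl } : Bits N →+ Bits b)
    ((I.1.orderEmbOfFin I.2).injective.surjective_comp_right) v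
  rw [card_bits, card_bits] at this
  exact this

section Ensemble
variable {n N b m K : ℕ}

/-- Expectations factor over the blocks. -/
theorem sum_ensemble_prod
    (k : Fin n → {s : Finset (Fin N) // s.card = b} → {A : Finset (Bits m) // A.card = K} → ℝ) :
    ∑ ω : Ensemble n N b m K, ∏ j, k j (ω.1 j) (ω.2 j) = ∏ j, ∑ I, ∑ A, k j I A := by
  classical
  have h : ∏ j, ∑ I, ∑ A, k j I A = ∏ j, ∑ p : {s : Finset (Fin N) // s.card = b} ×
      {A : Finset (Bits m) // A.card = K}, k j p.1 p.2 :=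
    Finset.prod_congr rfl fun j _ => (Fintype.sum_prod_type' _).symm
  rw [h, Finset.prod_univ_sum, Fintype.piFinset_univ]
  exact (Fintype.sum_equiv (Equiv.arrowProdEquivProdArrow (Fin n) (fun _ => _) (fun _ => _)) _ _
    fun _ => rfl).symm

theorem card_ensemble : (Fintype.card (Ensemble n N b m K) : ℝ) =
    ((Fintype.card {s : Finset (Fin N) // s.card = b} : ℝ) *
      Fintype.card {A : Finset (Bits m) // A.card = K}) ^ n := by
  rw [Fintype.card_prod, Fintype.card_fun, Fintype.card_fun, Fintype.card_fin]
  push_cast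
  rw [mul_pow]

/-- The number of index sets `I` such that `d` restricted to `I` lies in the kernel of `M`. -/
def kerCount (b : ℕ) {N m : ℕ} (M : Matrix (Fin m) (Fin b) (ZMod 2)) (d : Bits N) : ℕ :=
  (Finset.univ.filter fun I : {s : Finset (Fin N) // s.card = b} =>
    M.mulVec (restr I d) = 0).card

/-- The number of index sets of size `b` on which `d` vanishes. -/
def zeroCount (b : ℕ) {N : ℕ} (d : Bits N) : ℕ :=
  (Finset.univ.filter fun I : {s : Finset (Fin N) // s.card = b} => restr I d = 0).card

/-- Supplies the exact factor 2⁻ᵇ for agreement of two codewords on a block, averaged over their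
difference. -/
theorem sum_zeroCount : (∑ d : Bits N, (zeroCount b d : ℝ)) * 2 ^ b =
    Fintype.card {s : Finset (Fin N) // s.card = b} * 2 ^ N := by
  have h : ∑ d : Bits N, zeroCount b d = ∑ I : {s : Finset (Fin N) // s.card = b},
      (Finset.univ.filter fun d : Bits N => restr I d = 0).card := by
    simp only [zeroCount, Finset.card_filter]
    exact Finset.sum_comm
  have h2 : (∑ d : Bits N, zeroCount b d) * 2 ^ b =
      Fintype.card {s : Finset (Fin N) // s.card = b} * 2 ^ N := by
    rw [h, Finset.sum_mul]
    simp only [card_restr_eq_mul, Finset.sum_const, Finset.card_univ, smul_eq_mul]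
  exact_mod_cast h2

theorem sum_block (M : Matrix (Fin m) (Fin b) (ZMod 2)) (c : Bits N) (y : ZMod 2) :
    ∑ I : {s : Finset (Fin N) // s.card = b}, ∑ A : {A : Finset (Bits m) // A.card = K},
      (if indBit A.1 (M.mulVec (restr I c)) = y then (1 : ℝ) else 0) =
    (Fintype.card {s : Finset (Fin N) // s.card = b} *
      Fintype.card {A : Finset (Bits m) // A.card = K}) * bitProb K m y := by
  simp only [sum_indBit, Finset.sum_const, Finset.card_univ, nsmul_eq_mul]
  ring

theorem bitProb_nonneg (hK : K ≤ 2 ^ m) (y : ZMod 2) : 0 ≤ bitProb K m y := by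
  have hK' : (K : ℝ) / 2 ^ m ≤ 1 := by
    rw [div_le_one (by positivity)]; exact_mod_cast hK
  unfold bitProb; split_ifs
  · positivity
  · linarith

/-- If the syndromes coincide, the two events are one event; otherwise they are negatively
correlated. Only the first case, counted by `kerCount`, exceeds independence. -/
theorem sum_block_pair_le (hK : K ≤ 2 ^ m) (M : Matrix (Fin m) (Fin b) (ZMod 2)) (c c' : Bits N)
    (y : ZMod 2) :
    ∑ I : {s : Finset (Fin N) // s.card = b}, ∑ A : {A : Finset (Bits m) // A.card = K},
      (if indBit A.1 (M.mulVec (restr I c)) = y ∧ indBit A.1 (M.mulVec (restr I c')) = y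
        then (1 : ℝ) else 0) ≤
    Fintype.card {A : Finset (Bits m) // A.card = K} * bitProb K m y *
      (Fintype.card {s : Finset (Fin N) // s.card = b} * bitProb K m y +
        kerCount b M (c - c')) := by
  have hp := bitProb_nonneg hK y
  have h : ∀ I : {s : Finset (Fin N) // s.card = b},
      ∑ A : {A : Finset (Bits m) // A.card = K},
      (if indBit A.1 (M.mulVec (restr I c)) = y ∧ indBit A.1 (M.mulVec (restr I c')) = y
        then (1 : ℝ) else 0) ≤
      Fintype.card {A : Finset (Bits m) // A.card = K} * bitProb K m y *
        (bitProb K m y + if M.mulVec (restr I (c - c')) = 0 then 1 else 0) := by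
    intro I
    by_cases he : M.mulVec (restr I c) = M.mulVec (restr I c')
    · have h0 : M.mulVec (restr I (c - c')) = 0 := by
        rw [restr_sub, Matrix.mulVec_sub, he, sub_self]
      simp only [he, and_self, sum_indBit, h0, if_true]
      exact le_mul_of_one_le_right (by positivity) (by linarith)
    · refine (sum_indBit_pair_le hK he y).trans ?_
      rw [pow_two, ← mul_assoc]
      gcongr
      split_ifs <;> simp
  refine (Finset.sum_le_sum fun I _ => h I).trans (le_of_eq ?_)
  rw [← Finset.mul_sum, Finset.sum_add_distrib, Finset.sum_boole]
  simp [kerCount]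

/-- The crude bound that ignores the second codeword, used for bad differences. -/
theorem sum_block_pair_le' (M : Matrix (Fin m) (Fin b) (ZMod 2)) (c c' : Bits N) (y : ZMod 2) :
    ∑ I : {s : Finset (Fin N) // s.card = b}, ∑ A : {A : Finset (Bits m) // A.card = K},
      (if indBit A.1 (M.mulVec (restr I c)) = y ∧ indBit A.1 (M.mulVec (restr I c')) = y
        then (1 : ℝ) else 0) ≤
    (Fintype.card {s : Finset (Fin N) // s.card = b} *
      Fintype.card {A : Finset (Bits m) // A.card = K}) * bitProb K m y := by
  rw [← sum_block M c y]
  refine Finset.sum_le_sum fun I _ => Finset.sum_le_sum fun A _ => ?_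
  split_ifs with h1 h2 h2
  · exact le_rfl
  · exact absurd h1.1 h2
  · exact zero_le_one
  · exact le_rfl

theorem sum_block_pair_eq (M : Matrix (Fin m) (Fin b) (ZMod 2)) (c c' : Bits N) (y : ZMod 2) :
    ∑ I : {s : Finset (Fin N) // s.card = b}, ∑ A : {A : Finset (Bits m) // A.card = K},
      (if (indBit A.1 (M.mulVec (restr I c)) = y ∧ indBit A.1 (M.mulVec (restr I c')) = y) ∧
        restr I c = restr I c' then (1 : ℝ) else 0) =
    Fintype.card {A : Finset (Bits m) // A.card = K} * bitProb K m y * zeroCount b (c - c') := by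
  have h : ∀ I : {s : Finset (Fin N) // s.card = b},
      ∑ A : {A : Finset (Bits m) // A.card = K},
      (if (indBit A.1 (M.mulVec (restr I c)) = y ∧ indBit A.1 (M.mulVec (restr I c')) = y) ∧
        restr I c = restr I c' then (1 : ℝ) else 0) =
      Fintype.card {A : Finset (Bits m) // A.card = K} * bitProb K m y *
        if restr I (c - c') = 0 then 1 else 0 := by
    intro I
    simp only [restr_sub, sub_eq_zero]
    by_cases he : restr I c = restr I c'
    · simp only [he, and_self, and_true, sum_indBit, if_true, mul_one]
    · simp [he]
  rw [Finset.sum_congr rfl fun I _ => h I, ← Finset.mul_sum, Finset.sum_boole]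
  simp [zeroCount]

end Ensemble

end

/-! ### First and second moments of the cylinder sizes -/

section

variable {n N b m K : ℕ}

/-- All fibres of `M` have equal size, so this cardinality is the same for every choice of `A`. The
target mean of a cylinder is therefore not random. -/
theorem fibreCard_decoderMaps {M : Matrix (Fin m) (Fin b) (ZMod 2)} (hM : PairBalanced M)
    (A : Fin n → {A : Finset (Bits m) // A.card = K}) (i : Fin n) (y : ZMod 2) :
    (fibreCard (decoderMaps M A) i y : ℝ) = 2 ^ b * bitProb K m y := by
  have h1 : fibreCard (decoderMaps M A) i y =
      ∑ s ∈ Finset.univ.filter (fun s => indBit (A i).1 s = y),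
        (Finset.univ.filter fun v : Bits b => M.mulVec v = s).card := by
    unfold fibreCard
    rw [Finset.card_eq_sum_card_fiberwise (f := fun v => M.mulVec v)
      (t := Finset.univ.filter (fun s => indBit (A i).1 s = y))]
    · refine Finset.sum_congr rfl fun s hs => ?_
      rw [Finset.filter_filter]
      congr 1
      ext v
      simp only [Finset.mem_filter, Finset.mem_univ, true_and, and_iff_right_iff_imp] at hs ⊢
      rintro rfl
      exact hs
    · intro v hv
      simp only [Finset.coe_filter, Finset.mem_univ, true_and, Set.mem_ofPred_eq] at hv ⊢
      exact hv
  have h2 : fibreCard (decoderMaps M A) i y * 2 ^ m =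
      (Finset.univ.filter (fun s => indBit (A i).1 s = y)).card * 2 ^ b := by
    rw [h1, Finset.sum_mul]
    simp only [card_fibre_mul hM, Finset.sum_const, smul_eq_mul]
  have h3 : ((Finset.univ.filter (fun s => indBit (A i).1 s = y)).card : ℝ) =
      2 ^ m * bitProb K m y := by
    rcases zmod_two_cases y with rfl | rfl
    · have : (Finset.univ.filter (fun s => indBit (A i).1 s = 0)) = (A i).1ᶜ := by
        ext s; simp [indBit]
      rw [this, Finset.card_compl, card_bits, (A i).2, Nat.cast_sub]
      · simp [bitProb]; field_simp
      · rw [← (A i).2, ← card_bits]; exact Finset.card_le_univ _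
    · have : (Finset.univ.filter (fun s => indBit (A i).1 s = 1)) = (A i).1 := by
        ext s; simp [indBit]
      rw [this, (A i).2]
      simp [bitProb]; field_simp
  have h4 : (fibreCard (decoderMaps M A) i y : ℝ) * 2 ^ m = (2 ^ b * bitProb K m y) * 2 ^ m := by
    calc (fibreCard (decoderMaps M A) i y : ℝ) * 2 ^ m =
          ((Finset.univ.filter (fun s => indBit (A i).1 s = y)).card : ℝ) * 2 ^ b := by
            exact_mod_cast h2
      _ = _ := by rw [h3]; ring
  exact mul_right_cancel₀ (by positivity) h4

/-- The expected number of valid codewords. -/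
theorem sum_card_validCodewords (M : Matrix (Fin m) (Fin b) (ZMod 2)) (x : Bits n) :
    ∑ ω : Ensemble n N b m K, ((validCodewords ω.1 (decoderMaps M ω.2) x).card : ℝ) =
      Fintype.card (Ensemble n N b m K) * (2 ^ N * ∏ j, bitProb K m (x j)) := by
  have h : ∀ ω : Ensemble n N b m K, ((validCodewords ω.1 (decoderMaps M ω.2) x).card : ℝ) =
      ∑ c : Bits N, ∏ j, if indBit (ω.2 j).1 (M.mulVec (restr (ω.1 j) c)) = x j
        then (1 : ℝ) else 0 := by
    intro ω
    unfold validCodewords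
    rw [Finset.card_filter]
    push_cast
    refine Finset.sum_congr rfl fun c _ => ?_
    rw [Finset.prod_boole]
    simp only [Finset.mem_univ, true_imp_iff]
    rfl
  simp only [h]
  rw [Finset.sum_comm]
  have h2 : ∀ c : Bits N, ∑ ω : Ensemble n N b m K,
      ∏ j, (if indBit (ω.2 j).1 (M.mulVec (restr (ω.1 j) c)) = x j then (1 : ℝ) else 0) =
      Fintype.card (Ensemble n N b m K) * ∏ j, bitProb K m (x j) := by
    intro c
    rw [sum_ensemble_prod (fun j I A => if indBit A.1 (M.mulVec (restr I c)) = x j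
      then (1 : ℝ) else 0)]
    simp only [sum_block]
    rw [Finset.prod_mul_distrib, Finset.prod_const, card_ensemble, Finset.card_univ,
      Fintype.card_fin]
  simp only [h2, Finset.sum_const, Finset.card_univ, card_bits, nsmul_eq_mul]
  push_cast
  ring

/-- The squares count pairs of valid codewords agreeing on block `i`. Writing the agreement as a
condition on factor `j = i` makes the summand a product over blocks. -/
theorem sum_sq_card_cylinder_eq (M : Matrix (Fin m) (Fin b) (ZMod 2)) (x : Bits n) (i : Fin n)
    (ω : Ensemble n N b m K) :
    ∑ v, ((cylinder ω.1 (decoderMaps M ω.2) x i v).card : ℝ) ^ 2 =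
      ∑ c : Bits N, ∑ c' : Bits N, ∏ j,
        if (indBit (ω.2 j).1 (M.mulVec (restr (ω.1 j) c)) = x j ∧
            indBit (ω.2 j).1 (M.mulVec (restr (ω.1 j) c')) = x j) ∧
            (j = i → restr (ω.1 j) c = restr (ω.1 j) c') then (1 : ℝ) else 0 := by
  classical
  have h : ∀ v, ((cylinder ω.1 (decoderMaps M ω.2) x i v).card : ℝ) =
      ∑ c : Bits N, if (∀ j, indBit (ω.2 j).1 (M.mulVec (restr (ω.1 j) c)) = x j) ∧
        restr (ω.1 i) c = v then (1 : ℝ) else 0 := by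
    intro v
    unfold cylinder validCodewords
    rw [Finset.filter_filter, Finset.card_filter]
    push_cast
    rfl
  simp only [h, pow_two, Finset.sum_mul_sum]
  rw [Finset.sum_comm]
  refine Finset.sum_congr rfl fun c _ => ?_
  rw [Finset.sum_comm]
  refine Finset.sum_congr rfl fun c' _ => ?_
  rw [Finset.prod_boole]
  simp only [Finset.mem_univ, true_imp_iff, forall_and, forall_eq]
  by_cases h1 : ∀ j, indBit (ω.2 j).1 (M.mulVec (restr (ω.1 j) c)) = x j
  · by_cases h2 : ∀ j, indBit (ω.2 j).1 (M.mulVec (restr (ω.1 j) c')) = x j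
    · simp only [h1, h2, implies_true, true_and]
      simp only [ite_mul, one_mul, zero_mul, Finset.sum_ite_eq, Finset.mem_univ, if_true]
      simp only [eq_comm]
    · simp [h2]
  · simp [h1]

/-- Differences `d` for which the kernel event has probability more than `q₀`. -/
def badDiff (b : ℕ) (N : ℕ) {m : ℕ} (M : Matrix (Fin m) (Fin b) (ZMod 2)) (q₀ : ℝ) :
    Finset (Bits N) :=
  Finset.univ.filter fun d => q₀ * N.choose b < kerCount b M d

theorem card_index : Fintype.card {s : Finset (Fin N) // s.card = b} = N.choose b := by
  simp

/-- For a good difference, each block other than `i` costs at most a factor 1 + q₀/ρ over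
independence, and block `i` contributes validity times agreement. For a bad difference, only the
validity of `c` is kept. -/
theorem prod_block_le (hK : K ≤ 2 ^ m) (hbN : b ≤ N) (M : Matrix (Fin m) (Fin b) (ZMod 2))
    (x : Bits n) (i : Fin n) {ρ q₀ : ℝ} (hρ : 0 < ρ) (hq₀ : 0 ≤ q₀)
    (hp : ∀ j, ρ ≤ bitProb K m (x j)) (c c' : Bits N) :
    ∏ j, ∑ I : {s : Finset (Fin N) // s.card = b}, ∑ A : {A : Finset (Bits m) // A.card = K},
      (if (indBit A.1 (M.mulVec (restr I c)) = x j ∧ indBit A.1 (M.mulVec (restr I c')) = x j) ∧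
        (j = i → restr I c = restr I c') then (1 : ℝ) else 0) ≤
    Fintype.card (Ensemble n N b m K) *
      ((∏ j, bitProb K m (x j)) ^ 2 * (1 + q₀ / ρ) ^ n / bitProb K m (x i) *
        (zeroCount b (c - c') / N.choose b) +
        if c - c' ∈ badDiff b N M q₀ then ∏ j, bitProb K m (x j) else 0) := by
  set P : Fin n → ℝ := fun j => bitProb K m (x j)
  have hP : ∀ j, 0 < P j := fun j => hρ.trans_le (hp j)
  set D₁ : ℝ := (N.choose b : ℝ)
  have hD₁ : 0 < D₁ := by
    have := Nat.choose_pos hbN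
    simp only [D₁]; exact_mod_cast this
  set D₂ : ℝ := (Fintype.card {A : Finset (Bits m) // A.card = K} : ℝ)
  have hD₂ : 0 ≤ D₂ := Nat.cast_nonneg _
  have hcard : (Fintype.card (Ensemble n N b m K) : ℝ) = (D₁ * D₂) ^ n := by
    rw [card_ensemble, card_index]
  have hcI : (Fintype.card {s : Finset (Fin N) // s.card = b} : ℝ) = D₁ := by rw [card_index]
  have hnn : ∀ j, 0 ≤ ∑ I : {s : Finset (Fin N) // s.card = b},
      ∑ A : {A : Finset (Bits m) // A.card = K},
      (if (indBit A.1 (M.mulVec (restr I c)) = x j ∧ indBit A.1 (M.mulVec (restr I c')) = x j) ∧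
        (j = i → restr I c = restr I c') then (1 : ℝ) else 0) := fun j =>
    Finset.sum_nonneg fun I _ => Finset.sum_nonneg fun A _ => by split_ifs <;> simp
  have hle : ∀ j, ∑ I : {s : Finset (Fin N) // s.card = b},
      ∑ A : {A : Finset (Bits m) // A.card = K},
      (if (indBit A.1 (M.mulVec (restr I c)) = x j ∧ indBit A.1 (M.mulVec (restr I c')) = x j) ∧
        (j = i → restr I c = restr I c') then (1 : ℝ) else 0) ≤
      ∑ I : {s : Finset (Fin N) // s.card = b}, ∑ A : {A : Finset (Bits m) // A.card = K},
      (if (indBit A.1 (M.mulVec (restr I c)) = x j ∧ indBit A.1 (M.mulVec (restr I c')) = x j)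
        then (1 : ℝ) else 0) := fun j =>
    Finset.sum_le_sum fun I _ => Finset.sum_le_sum fun A _ => by
      split_ifs with h1 h2 h2
      · exact le_rfl
      · exact absurd h1.1 h2
      · exact zero_le_one
      · exact le_rfl
  rw [hcard]
  by_cases hbad : c - c' ∈ badDiff b N M q₀
  · rw [if_pos hbad]
    have h1 := Finset.prod_le_prod (s := Finset.univ) (fun j _ => hnn j)
      (fun j _ => (hle j).trans (sum_block_pair_le' M c c' (x j)))
    refine h1.trans ?_
    rw [Finset.prod_mul_distrib, Finset.prod_const, Finset.card_univ, Fintype.card_fin, hcI]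
    have h2 : 0 ≤ (∏ j, P j) ^ 2 * (1 + q₀ / ρ) ^ n / P i * (zeroCount b (c - c') / D₁) := by
      have := hP i
      positivity
    gcongr
    exact le_add_of_nonneg_left h2
  · rw [if_neg hbad, add_zero]
    have hker : (kerCount b M (c - c') : ℝ) ≤ q₀ * D₁ := by
      by_contra hcon
      exact hbad (Finset.mem_filter.2 ⟨Finset.mem_univ _, not_le.1 hcon⟩)
    set z : ℝ := zeroCount b (c - c') / D₁
    have hz : 0 ≤ z := by positivity
    have hfac : ∀ j, ∑ I : {s : Finset (Fin N) // s.card = b},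
        ∑ A : {A : Finset (Bits m) // A.card = K},
        (if (indBit A.1 (M.mulVec (restr I c)) = x j ∧
          indBit A.1 (M.mulVec (restr I c')) = x j) ∧
          (j = i → restr I c = restr I c') then (1 : ℝ) else 0) ≤
        (D₁ * D₂) * ((if j = i then z / P i else 1) * P j ^ 2 * (1 + q₀ / ρ)) := by
      intro j
      by_cases hj : j = i
      · subst hj
        simp only [true_imp_iff, if_true]
        rw [sum_block_pair_eq]
        have e : (D₁ * D₂) * (z / P j * P j ^ 2 * (1 + q₀ / ρ)) =
            (D₂ * P j * (z * D₁)) * (1 + q₀ / ρ) := by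
          have := (hP j).ne'
          field_simp
        rw [e]
        simp only [z]
        rw [div_mul_cancel₀ _ hD₁.ne']
        refine le_mul_of_one_le_right ?_ ?_
        · have := (hP j).le
          positivity
        · simp only [le_add_iff_nonneg_right]; positivity
      · refine (hle j).trans ((sum_block_pair_le hK M c c' (x j)).trans ?_)
        rw [if_neg hj, hcI]
        change D₂ * P j * (D₁ * P j + _) ≤ _
        have hq : q₀ ≤ P j * (q₀ / ρ) := by
          rw [mul_div_assoc', le_div_iff₀ hρ, mul_comm]
          exact mul_le_mul_of_nonneg_right (hp j) hq₀
        have hPj := (hP j).le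
        calc D₂ * P j * (D₁ * P j + kerCount b M (c - c'))
            ≤ D₂ * P j * (D₁ * P j + (P j * (q₀ / ρ)) * D₁) := by
              have : q₀ * D₁ ≤ (P j * (q₀ / ρ)) * D₁ := mul_le_mul_of_nonneg_right hq hD₁.le
              gcongr
              exact hker.trans this
          _ = _ := by ring
    have h1 := Finset.prod_le_prod (s := Finset.univ) (fun j _ => hnn j) (fun j _ => hfac j)
    refine h1.trans (le_of_eq ?_)
    rw [Finset.prod_mul_distrib, Finset.prod_mul_distrib, Finset.prod_mul_distrib,
      Finset.prod_mul_distrib,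
      Finset.prod_const, Finset.prod_const, Finset.prod_const, Finset.prod_pow,
      Finset.prod_ite_eq', Finset.card_univ, Fintype.card_fin, if_pos (Finset.mem_univ _)]
    change _ = (D₁ * D₂) ^ n * ((∏ j, P j) ^ 2 * (1 + q₀ / ρ) ^ n / P i * z)
    ring

/-- The expected sum of squared cylinder sizes. -/
theorem sum_sum_sq_card_cylinder_le (hK : K ≤ 2 ^ m) (hbN : b ≤ N)
    (M : Matrix (Fin m) (Fin b) (ZMod 2)) (x : Bits n) (i : Fin n) {ρ q₀ : ℝ} (hρ : 0 < ρ)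
    (hq₀ : 0 ≤ q₀) (hp : ∀ j, ρ ≤ bitProb K m (x j)) :
    ∑ ω : Ensemble n N b m K, ∑ v, ((cylinder ω.1 (decoderMaps M ω.2) x i v).card : ℝ) ^ 2 ≤
      Fintype.card (Ensemble n N b m K) * (2 ^ N *
        ((∏ j, bitProb K m (x j)) ^ 2 * (1 + q₀ / ρ) ^ n / bitProb K m (x i) * (2 ^ N / 2 ^ b) +
          (badDiff b N M q₀).card * ∏ j, bitProb K m (x j))) := by
  have hD₁ : (0 : ℝ) < N.choose b := by exact_mod_cast Nat.choose_pos hbN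
  simp only [sum_sq_card_cylinder_eq]
  rw [Finset.sum_comm]
  have h1 : ∀ c : Bits N, ∑ ω : Ensemble n N b m K, ∑ c' : Bits N, ∏ j,
        (if (indBit (ω.2 j).1 (M.mulVec (restr (ω.1 j) c)) = x j ∧
            indBit (ω.2 j).1 (M.mulVec (restr (ω.1 j) c')) = x j) ∧
            (j = i → restr (ω.1 j) c = restr (ω.1 j) c') then (1 : ℝ) else 0) ≤
      Fintype.card (Ensemble n N b m K) *
        ((∏ j, bitProb K m (x j)) ^ 2 * (1 + q₀ / ρ) ^ n / bitProb K m (x i) * (2 ^ N / 2 ^ b) +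
          (badDiff b N M q₀).card * ∏ j, bitProb K m (x j)) := by
    intro c
    rw [Finset.sum_comm]
    have h2 : ∀ c' : Bits N, ∑ ω : Ensemble n N b m K, ∏ j,
        (if (indBit (ω.2 j).1 (M.mulVec (restr (ω.1 j) c)) = x j ∧
            indBit (ω.2 j).1 (M.mulVec (restr (ω.1 j) c')) = x j) ∧
            (j = i → restr (ω.1 j) c = restr (ω.1 j) c') then (1 : ℝ) else 0) ≤
        Fintype.card (Ensemble n N b m K) *
        ((∏ j, bitProb K m (x j)) ^ 2 * (1 + q₀ / ρ) ^ n / bitProb K m (x i) *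
        (zeroCount b (c - c') / N.choose b) +
        if c - c' ∈ badDiff b N M q₀ then ∏ j, bitProb K m (x j) else 0) := by
      intro c'
      rw [sum_ensemble_prod (fun j I A =>
        if (indBit A.1 (M.mulVec (restr I c)) = x j ∧ indBit A.1 (M.mulVec (restr I c')) = x j) ∧
        (j = i → restr I c = restr I c') then (1 : ℝ) else 0)]
      exact prod_block_le hK hbN M x i hρ hq₀ hp c c'
    refine (Finset.sum_le_sum fun c' _ => h2 c').trans (le_of_eq ?_)
    -- The bound depends on `c'` only through d = c - c', which runs over all strings.
    have hsub := (Equiv.subLeft c).sum_comp (fun d =>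
        ((∏ j, bitProb K m (x j)) ^ 2 * (1 + q₀ / ρ) ^ n / bitProb K m (x i) *
        ((zeroCount b d : ℝ) / N.choose b) +
        if d ∈ badDiff b N M q₀ then ∏ j, bitProb K m (x j) else 0))
    simp only [Equiv.subLeft_apply] at hsub
    rw [← Finset.mul_sum, hsub,
      Finset.sum_add_distrib, ← Finset.mul_sum, ← Finset.sum_div]
    congr 2
    · congr 1
      have := sum_zeroCount (b := b) (N := N)
      rw [card_index] at this
      rw [div_eq_div_iff hD₁.ne' (by positivity), this, mul_comm]
    · rw [Finset.sum_ite_mem, Finset.univ_inter, Finset.sum_const, nsmul_eq_mul]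
  refine (Finset.sum_le_sum fun c _ => h1 c).trans (le_of_eq ?_)
  simp only [Finset.sum_const, Finset.card_univ, card_bits, nsmul_eq_mul]
  push_cast
  ring

/-- The expected squared deviation of the cylinder sizes from their mean. -/
theorem sum_sum_sq_deviation_le {M : Matrix (Fin m) (Fin b) (ZMod 2)} (hM : PairBalanced M)
    (hK : K ≤ 2 ^ m) (hbN : b ≤ N) (x : Bits n) (i : Fin n) {ρ q₀ κ F μ : ℝ}
    (hρ : 0 < ρ) (hq₀ : 0 ≤ q₀) (hp : ∀ j, ρ ≤ bitProb K m (x j))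
    (hF : F = 2 ^ b * bitProb K m (x i)) (hμ : F * μ = 2 ^ N * ∏ j, bitProb K m (x j))
    (hκ : (1 + q₀ / ρ) ^ n - 1 +
      (badDiff b N M q₀).card * 2 ^ b / (2 ^ N * ∏ j, bitProb K m (x j)) ≤ κ) :
    ∑ ω : Ensemble n N b m K, ∑ v, (((cylinder ω.1 (decoderMaps M ω.2) x i v).card : ℝ) -
      if decoderMaps M ω.2 i v = x i then μ else 0) ^ 2 ≤
      Fintype.card (Ensemble n N b m K) * (F * μ ^ 2 * κ) := by
  have hP : ∀ j, 0 < bitProb K m (x j) := fun j => hρ.trans_le (hp j)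
  set Q : ℝ := ∏ j, bitProb K m (x j)
  have hQ : 0 < Q := Finset.prod_pos fun j _ => hP j
  have hF0 : 0 < F := by rw [hF]; have := hP i; positivity
  -- Expanding the square leaves only the second moment and the total number of valid codewords,
  -- since cylinders off the fibre are empty.
  have hpt : ∀ ω : Ensemble n N b m K,
      ∑ v, (((cylinder ω.1 (decoderMaps M ω.2) x i v).card : ℝ) -
      if decoderMaps M ω.2 i v = x i then μ else 0) ^ 2 =
      ∑ v, ((cylinder ω.1 (decoderMaps M ω.2) x i v).card : ℝ) ^ 2 -
        2 * μ * (validCodewords ω.1 (decoderMaps M ω.2) x).card + F * μ ^ 2 := by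
    intro ω
    have h1 : ∀ v, (((cylinder ω.1 (decoderMaps M ω.2) x i v).card : ℝ) -
        if decoderMaps M ω.2 i v = x i then μ else 0) ^ 2 =
        ((cylinder ω.1 (decoderMaps M ω.2) x i v).card : ℝ) ^ 2 -
        2 * μ * (cylinder ω.1 (decoderMaps M ω.2) x i v).card +
        (if decoderMaps M ω.2 i v = x i then μ ^ 2 else 0) := by
      intro v
      by_cases hv : decoderMaps M ω.2 i v = x i
      · simp only [hv, if_true]; ring
      · simp [hv, cylinder_eq_empty hv]
    simp only [h1]
    rw [Finset.sum_add_distrib, Finset.sum_sub_distrib, ← Finset.mul_sum, sum_card_cylinder,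
      ← Finset.sum_filter, Finset.sum_const, nsmul_eq_mul]
    congr 2
    rw [hF, ← fibreCard_decoderMaps hM ω.2 i (x i)]
    rfl
  simp only [hpt]
  rw [Finset.sum_add_distrib, Finset.sum_sub_distrib, ← Finset.mul_sum, sum_card_validCodewords,
    Finset.sum_const, Finset.card_univ, nsmul_eq_mul]
  set D : ℝ := (Fintype.card (Ensemble n N b m K) : ℝ)
  have hD : 0 ≤ D := Nat.cast_nonneg _
  have h2 := sum_sum_sq_card_cylinder_le hK hbN M x i hρ hq₀ hp
  have hPi := hP i
  have hμe : μ = 2 ^ N * Q / F := by rw [← hμ]; field_simp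
  have e1 : 2 ^ N * (Q ^ 2 * (1 + q₀ / ρ) ^ n / bitProb K m (x i) * (2 ^ N / 2 ^ b) +
      (badDiff b N M q₀).card * Q) =
      F * μ ^ 2 * ((1 + q₀ / ρ) ^ n + bitProb K m (x i) *
        ((badDiff b N M q₀).card * 2 ^ b / (2 ^ N * Q))) := by
    rw [hμe, hF]; field_simp
  have hPle : bitProb K m (x i) ≤ 1 := by
    have : (0 : ℝ) ≤ K / 2 ^ m := by positivity
    have h' : (K : ℝ) / 2 ^ m ≤ 1 := by
      rw [div_le_one (by positivity)]; exact_mod_cast hK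
    unfold bitProb; split_ifs <;> linarith
  have e2 : bitProb K m (x i) * ((badDiff b N M q₀).card * 2 ^ b / (2 ^ N * Q)) ≤
      (badDiff b N M q₀).card * 2 ^ b / (2 ^ N * Q) :=
    mul_le_of_le_one_left (by positivity) hPle
  calc _ ≤ D * (F * μ ^ 2 * ((1 + q₀ / ρ) ^ n + bitProb K m (x i) *
        ((badDiff b N M q₀).card * 2 ^ b / (2 ^ N * Q)))) - 2 * μ * (D * (2 ^ N * Q)) +
        D * (F * μ ^ 2) := by rw [← e1]; gcongr
    _ = D * (F * μ ^ 2 * ((1 + q₀ / ρ) ^ n - 1 + bitProb K m (x i) *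
        ((badDiff b N M q₀).card * 2 ^ b / (2 ^ N * Q)))) := by rw [← hμ]; ring
    _ ≤ _ := by
        gcongr
        linarith

end

/-! ### Bad differences and the probability of success -/

section

variable {n N b m K : ℕ}

/-- Passes from index sets, used by the ensemble, to increasing maps, on which the induction on the
first bit runs. -/
theorem restr_count_le_occ (d : Bits N) (v : Bits b) :
    (Finset.univ.filter fun I : {s : Finset (Fin N) // s.card = b} => restr I d = v).card ≤
      occ d v := by
  classical
  unfold occ
  refine Finset.card_le_card_of_injOn (fun I k => I.1.orderEmbOfFin I.2 k) ?_ ?_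
  · intro I hI
    have hI' := (Finset.mem_filter.1 (Finset.mem_coe.1 hI)).2
    refine Finset.mem_coe.2 (Finset.mem_filter.2 ⟨Finset.mem_univ _,
      (I.1.orderEmbOfFin I.2).strictMono, fun k => congrFun hI' k⟩)
  · intro I _ J _ h
    have h' : Set.range (I.1.orderEmbOfFin I.2) = Set.range (J.1.orderEmbOfFin J.2) :=
      congrArg Set.range h
    rw [Finset.range_orderEmbOfFin, Finset.range_orderEmbOfFin] at h'
    exact Subtype.ext (Finset.coe_injective h')

/-- Pigeonhole over the kernel: a bad `d` has some kernel word occurring more than a fraction q₀/k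
of the time. -/
theorem card_badDiff_le (hb : b < N) (M : Matrix (Fin m) (Fin b) (ZMod 2)) {q₀ : ℝ}
    (hq₀ : 0 < q₀) (s : ℕ) {k : ℝ}
    (hk : ((Finset.univ.filter fun v : Bits b => M.mulVec v = 0).card : ℝ) ≤ k) :
    ((badDiff b N M q₀).card : ℝ) ≤
      k * ((1 + 1 / (1 + (b : ℝ) / (N - b : ℝ)) ^ (s + 1)) ^ N *
        ((N + 1) * k / q₀) ^ (s + 1)) := by
  classical
  set ker := Finset.univ.filter fun v : Bits b => M.mulVec v = 0
  have hkpos : 0 < k := by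
    refine lt_of_lt_of_le ?_ hk
    have : (0 : Bits b) ∈ ker := Finset.mem_filter.2 ⟨Finset.mem_univ _, Matrix.mulVec_zero M⟩
    exact_mod_cast Finset.card_pos.2 ⟨0, this⟩
  have hNb : (0 : ℝ) < N - b := by
    have : (b : ℝ) < N := by exact_mod_cast hb
    linarith
  have hcount : ∀ d : Bits N, (kerCount b M d : ℝ) ≤ ∑ v ∈ ker, (occ d v : ℝ) := by
    intro d
    have h1 : kerCount b M d = ∑ v ∈ ker, (Finset.univ.filter
        fun I : {s : Finset (Fin N) // s.card = b} => restr I d = v).card := by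
      unfold kerCount
      rw [Finset.card_eq_sum_card_fiberwise (f := fun I => restr I d) (t := ker)]
      · refine Finset.sum_congr rfl fun v hv => ?_
        rw [Finset.filter_filter]
        congr 1
        ext I
        simp only [Finset.mem_filter, Finset.mem_univ, true_and, and_iff_right_iff_imp]
        rintro rfl
        exact (Finset.mem_filter.1 hv).2
      · intro I hI
        have hI' := (Finset.mem_filter.1 (Finset.mem_coe.1 hI)).2
        exact Finset.mem_coe.2 (Finset.mem_filter.2 ⟨Finset.mem_univ _, hI'⟩)
    rw [h1]
    push_cast
    exact Finset.sum_le_sum fun v _ => by exact_mod_cast restr_count_le_occ d v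
  have hsub : badDiff b N M q₀ ⊆ ker.biUnion fun v =>
      Finset.univ.filter fun d : Bits N => q₀ / k * N.choose b < occ d v := by
    intro d hd
    have hd' := (Finset.mem_filter.1 hd).2
    by_contra hcon
    simp only [Finset.mem_biUnion, Finset.mem_filter, Finset.mem_univ, true_and, not_exists,
      not_and, not_lt] at hcon
    have h2 : ∑ v ∈ ker, (occ d v : ℝ) ≤ ker.card * (q₀ / k * N.choose b) := by
      rw [← nsmul_eq_mul]
      exact Finset.sum_le_card_nsmul _ _ _ hcon
    have h3 : (ker.card : ℝ) * (q₀ / k * N.choose b) ≤ k * (q₀ / k * N.choose b) := by gcongr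
    have h4 : k * (q₀ / k * N.choose b) = q₀ * N.choose b := by field_simp
    linarith [hcount d]
  set B : ℝ := (1 + 1 / (1 + (b : ℝ) / (N - b : ℝ)) ^ (s + 1)) ^ N *
        ((N + 1) * k / q₀) ^ (s + 1)
  have hB : ∀ v ∈ ker, ((Finset.univ.filter fun d : Bits N =>
      q₀ / k * N.choose b < occ d v).card : ℝ) ≤ B := by
    intro v _
    have := card_occ_gt_le hb v (div_pos hq₀ hkpos) s
    rw [div_div_eq_mul_div] at this
    exact this
  have h5 : ((badDiff b N M q₀).card : ℝ) ≤ ∑ v ∈ ker, ((Finset.univ.filter fun d : Bits N =>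
      q₀ / k * N.choose b < occ d v).card : ℝ) := by
    exact_mod_cast (Finset.card_le_card hsub).trans Finset.card_biUnion_le
  have hB0 : 0 ≤ B := by positivity
  calc ((badDiff b N M q₀).card : ℝ) ≤ ∑ v ∈ ker, B := h5.trans (Finset.sum_le_sum hB)
    _ = ker.card * B := by rw [Finset.sum_const, nsmul_eq_mul]
    _ ≤ k * B := by gcongr

theorem card_filter_mul_le_sum {Ω : Type*} [Fintype Ω] {X : Ω → ℝ} (hX : ∀ ω, 0 ≤ X ω) (a : ℝ)
    [DecidablePred fun ω => a < X ω] :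
    ((Finset.univ.filter fun ω => a < X ω).card : ℝ) * a ≤ ∑ ω, X ω := by
  calc ((Finset.univ.filter fun ω => a < X ω).card : ℝ) * a
      = ∑ ω ∈ Finset.univ.filter (fun ω => a < X ω), a := by rw [Finset.sum_const, nsmul_eq_mul]
    _ ≤ ∑ ω ∈ Finset.univ.filter (fun ω => a < X ω), X ω :=
        Finset.sum_le_sum fun ω hω => (Finset.mem_filter.1 hω).2.le
    _ ≤ _ := Finset.sum_le_sum_of_subset_of_nonneg (Finset.subset_univ _) fun ω _ _ => hX ω

/-- A union bound for `ensembleProb`. -/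
theorem one_sub_le_ensembleProb (hbN : b ≤ N) (hK : K ≤ 2 ^ m) {E : Ensemble n N b m K → Prop}
    (S : Fin n → Finset (Ensemble n N b m K)) {β : ℝ}
    (hS : ∀ i, ((S i).card : ℝ) ≤ β * Fintype.card (Ensemble n N b m K))
    (hE : ∀ ω, (∀ i, ω ∉ S i) → E ω) : 1 - n * β ≤ ensembleProb E := by
  classical
  have hpos : (0 : ℝ) < Fintype.card (Ensemble n N b m K) := by
    rw [card_ensemble, card_index, Fintype.card_finset_len, card_bits]
    have h1 : (0 : ℝ) < N.choose b := by exact_mod_cast Nat.choose_pos hbN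
    have h2 : (0 : ℝ) < (2 ^ m).choose K := by exact_mod_cast Nat.choose_pos hK
    positivity
  unfold ensembleProb
  rw [Nat.card_eq_fintype_card, Nat.card_eq_fintype_card, le_div_iff₀ hpos, Fintype.card_subtype]
  have hcov : (Finset.univ : Finset (Ensemble n N b m K)) ⊆
      Finset.univ.filter E ∪ Finset.univ.biUnion S := by
    intro ω _
    by_cases h : ∀ i, ω ∉ S i
    · exact Finset.mem_union_left _ (Finset.mem_filter.2 ⟨Finset.mem_univ _, hE ω h⟩)
    · push Not at h
      obtain ⟨i, hi⟩ := h
      exact Finset.mem_union_right _ (Finset.mem_biUnion.2 ⟨i, Finset.mem_univ _, hi⟩)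
  have h1 : Fintype.card (Ensemble n N b m K) ≤ (Finset.univ.filter E).card +
      ∑ i, (S i).card := by
    rw [← Finset.card_univ]
    refine (Finset.card_le_card hcov).trans ((Finset.card_union_le _ _).trans ?_)
    gcongr
    exact Finset.card_biUnion_le
  have h2 : (Fintype.card (Ensemble n N b m K) : ℝ) ≤ (Finset.univ.filter E).card +
      ∑ i, ((S i).card : ℝ) := by exact_mod_cast h1
  have h3 : ∑ i, ((S i).card : ℝ) ≤ ∑ _i : Fin n, β * Fintype.card (Ensemble n N b m K) :=
    Finset.sum_le_sum fun i _ => hS i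
  rw [Finset.sum_const, Finset.card_univ, Fintype.card_fin, nsmul_eq_mul] at h3
  linarith

/-- Markov's inequality for the squared deviation in each block, a union bound over blocks, and
Cauchy-Schwarz to reach the ℓ¹ hypothesis of `exists_eligible_of_near`. -/
theorem ensembleProb_eligible_ge {M : Matrix (Fin m) (Fin b) (ZMod 2)} (hM : PairBalanced M)
    (hb : 2 ≤ b) (hn : 2 ≤ n) (hbN : b ≤ N) (hK : K ≤ 2 ^ m) (x : Bits n) {ρ q₀ κ ξ : ℝ}
    (hρ : 0 < ρ) (hq₀ : 0 ≤ q₀) (hp : ∀ j, ρ ≤ bitProb K m (x j))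
    (hκ : (1 + q₀ / ρ) ^ n - 1 +
      (badDiff b N M q₀).card * 2 ^ b / (2 ^ N * ∏ j, bitProb K m (x j)) ≤ κ)
    (hξ0 : 0 < ξ) (hξ : 4 * n * ξ * (1 + n ^ 4 / ρ) ≤ 1 / (4 * (n : ℝ) ^ 4)) :
    1 - n * (κ / ξ ^ 2) ≤ ensembleProb (fun ω : Ensemble n N b m K =>
      ∃ η ∈ eligible ω.1 (decoderMaps M ω.2) x,
        idealVec (decoderMaps M ω.2) x + η ∈ generated ω.1 ∧
        ∃ τ : ℝ, 0 < τ ∧ τ ≤ 1 / ((n : ℝ) * 2 ^ b) ∧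
          (expurgated ω.1 (decoderMaps M ω.2) x τ).Nonempty ∧
          idealVec (decoderMaps M ω.2) x + η =
            distVec ω.1 (uniformDist (expurgated ω.1 (decoderMaps M ω.2) x τ))) := by
  classical
  have hP : ∀ j, 0 < bitProb K m (x j) := fun j => hρ.trans_le (hp j)
  set Q : ℝ := ∏ j, bitProb K m (x j)
  have hQ : 0 < Q := Finset.prod_pos fun j _ => hP j
  set F : Fin n → ℝ := fun i => 2 ^ b * bitProb K m (x i)
  have hF0 : ∀ i, 0 < F i := fun i => by have := hP i; positivity
  set μ : Fin n → ℝ := fun i => 2 ^ N * Q / F i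
  have hμ0 : ∀ i, 0 < μ i := fun i => by have := hF0 i; positivity
  set X : Fin n → Ensemble n N b m K → ℝ := fun i ω =>
    ∑ v, (((cylinder ω.1 (decoderMaps M ω.2) x i v).card : ℝ) -
      if decoderMaps M ω.2 i v = x i then μ i else 0) ^ 2
  have hX : ∀ i ω, 0 ≤ X i ω := fun i ω => Finset.sum_nonneg fun v _ => sq_nonneg _
  refine one_sub_le_ensembleProb hbN hK
    (fun i => Finset.univ.filter fun ω => ξ ^ 2 * (F i * μ i ^ 2) < X i ω) ?_ ?_
  · intro i
    have hFi := hF0 i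
    have hμi := hμ0 i
    have h1 := card_filter_mul_le_sum (hX i) (ξ ^ 2 * (F i * μ i ^ 2))
    have h2 := sum_sum_sq_deviation_le hM hK hbN x i hρ hq₀ hp (F := F i) (μ := μ i) rfl
      (mul_div_cancel₀ _ hFi.ne') hκ
    have h3 := h1.trans h2
    rw [← le_div_iff₀ (by positivity)] at h3
    refine h3.trans (le_of_eq ?_)
    field_simp
  · intro ω hω
    refine exists_eligible_of_near hM hb hn ω.1 ω.2 x hρ ?_ hμ0 hξ0.le hξ ?_
    · intro i
      rw [fibreCard_decoderMaps hM, mul_comm]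
      exact mul_le_mul_of_nonneg_left (hp i) (by positivity)
    · intro i
      have hFi := hF0 i
      have hμi := hμ0 i
      have hXi : X i ω ≤ ξ ^ 2 * (F i * μ i ^ 2) := by
        have := hω i
        simpa using this
      have hfc : (fibreCard (decoderMaps M ω.2) i (x i) : ℝ) = F i :=
        fibreCard_decoderMaps hM ω.2 i (x i)
      rw [hfc]
      set g : Bits b → ℝ := fun v => |((cylinder ω.1 (decoderMaps M ω.2) x i v).card : ℝ) -
        if decoderMaps M ω.2 i v = x i then μ i else 0|
      have hg0 : ∀ v, 0 ≤ g v := fun v => abs_nonneg _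
      -- Restricting to the fibre first makes Cauchy-Schwarz cost a factor F instead of 2ᵇ.
      have hsum : ∑ v, g v =
          ∑ v ∈ Finset.univ.filter (fun v => decoderMaps M ω.2 i v = x i), g v := by
        refine (Finset.sum_subset (Finset.subset_univ _) fun v _ hv => ?_).symm
        have hv' : decoderMaps M ω.2 i v ≠ x i := by simpa using hv
        simp [g, hv', cylinder_eq_empty hv']
      have hcs : (∑ v, g v) ^ 2 ≤ (ξ * (F i * μ i)) ^ 2 := by
        rw [hsum]
        refine sq_sum_le_card_mul_sum_sq.trans ?_
        change (fibreCard (decoderMaps M ω.2) i (x i) : ℝ) * _ ≤ _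
        rw [hfc]
        have h1 : ∑ v ∈ Finset.univ.filter (fun v => decoderMaps M ω.2 i v = x i), g v ^ 2 ≤
            X i ω := by
          simp only [g, sq_abs]
          exact Finset.sum_le_sum_of_subset_of_nonneg (Finset.subset_univ _)
            fun v _ _ => sq_nonneg _
        calc F i * _ ≤ F i * (ξ ^ 2 * (F i * μ i ^ 2)) := by
              gcongr
              exact h1.trans hXi
          _ = _ := by ring
      exact (abs_le_of_sq_le_sq' hcs (by positivity)).2

end

/-! ### Entropy gap and asymptotic estimates -/

/-- The exponent `-q log p - (1 - q) log (1 - p)` (natural logarithms). -/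
def crossEntropy (q p : ℝ) : ℝ := -(q * Real.log p) - (1 - q) * Real.log (1 - p)

/-- The difference of the two sides vanishes at ε = 0. With h' = log((1-p)/p), its derivative there
is h' + h'/2 - 2·(h'/2) = h'/2 > 0. -/
theorem exists_entropy_gap {p : ℝ} (hp0 : 0 < p) (hp : p < 1 / 2) :
    ∃ ε₀ : ℝ, 0 < ε₀ ∧ ∀ ε : ℝ, 0 < ε → ε ≤ ε₀ →
      2 * crossEntropy (p + ε / 2) p <
        Real.binEntropy (p + ε) + Real.binEntropy (p + ε / 2) := by
  set J : ℝ → ℝ := fun ε => Real.binEntropy (p + ε) + Real.binEntropy (p + ε / 2) -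
    2 * crossEntropy (p + ε / 2) p
  set h' : ℝ := Real.log (1 - p) - Real.log p
  have hh' : 0 < h' := by
    have := Real.log_lt_log hp0 (show p < 1 - p by linarith)
    simp only [h']; linarith
  have hbe : HasDerivAt Real.binEntropy h' p :=
    Real.hasDerivAt_binEntropy hp0.ne' (by linarith)
  have h1 : HasDerivAt (fun ε : ℝ => Real.binEntropy (p + ε)) h' 0 := by
    have hi : HasDerivAt (fun ε : ℝ => p + ε) 1 0 := (hasDerivAt_id 0).const_add p
    have hbe' : HasDerivAt Real.binEntropy h' (p + 0) := by rwa [add_zero]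
    exact (hbe'.comp (0 : ℝ) hi).congr_deriv (mul_one _)
  have hi2 : HasDerivAt (fun ε : ℝ => p + ε / 2) (1 / 2) 0 :=
    ((hasDerivAt_id (0 : ℝ)).div_const 2).const_add p
  have h2 : HasDerivAt (fun ε : ℝ => Real.binEntropy (p + ε / 2)) (h' * (1 / 2)) 0 := by
    have hbe' : HasDerivAt Real.binEntropy h' (p + 0 / 2) := by simpa using hbe
    exact hbe'.comp (0 : ℝ) hi2
  have h3 : HasDerivAt (fun ε : ℝ => crossEntropy (p + ε / 2) p) (h' / 2) 0 := by
    have ha := (hi2.mul_const (Real.log p)).neg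
    have hb := ((hi2.const_sub 1).mul_const (Real.log (1 - p)))
    refine (ha.sub hb).congr_deriv ?_
    simp only [h']; ring
  have hJ : HasDerivAt J (h' / 2) 0 := by
    refine ((h1.add h2).sub (h3.const_mul 2)).congr_deriv ?_
    ring
  have hJ0 : J 0 = 0 := by
    simp only [J, crossEntropy, Real.binEntropy_eq_negMulLog_add_negMulLog_one_sub, Real.negMulLog,
      add_zero, zero_div]
    ring
  have hslope := hasDerivAt_iff_tendsto_slope_zero.1 hJ
  have hev : ∀ᶠ t in 𝓝[≠] (0 : ℝ), 0 < t⁻¹ • (J (0 + t) - J 0) :=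
    hslope.eventually (lt_mem_nhds (by linarith))
  rw [eventually_nhdsWithin_iff, Metric.eventually_nhds_iff] at hev
  obtain ⟨r, hr, hev⟩ := hev
  refine ⟨r / 2, by linarith, fun ε hε hεr => ?_⟩
  have hd : dist ε 0 < r := by
    rw [Real.dist_eq, sub_zero, abs_of_pos hε]; linarith
  have := hev hd hε.ne'
  rw [zero_add, hJ0, sub_zero, smul_eq_mul] at this
  have h4 : 0 < J ε := (pos_iff_pos_of_mul_pos this).1 (inv_pos.2 hε)
  simp only [J] at h4
  linarith

theorem card_badDiff_le_exp {n N b m : ℕ} {ε' : ℝ} (h0 : 0 < ε') (h1 : ε' < 1 / 2) (hn : 2 ≤ n)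
    (hb0 : 0 < b) (hb : b < N) (hNn : N ≤ n) (hbl : 100 * Real.log n / ε' ≤ b)
    (M : Matrix (Fin m) (Fin b) (ZMod 2))
    (hk : ((Finset.univ.filter fun v : Bits b => M.mulVec v = 0).card : ℝ) ≤ (n : ℝ) ^ 10) :
    ((badDiff b N M ((n : ℝ) ^ 60)⁻¹).card : ℝ) ≤
      Real.exp (N * Real.binEntropy ε' + 154 * Real.log n) := by
  have hn' : (2 : ℝ) ≤ n := by exact_mod_cast hn
  have hn0 : (0 : ℝ) < n := by linarith
  have hb' : (0 : ℝ) < b := by exact_mod_cast hb0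
  have hbN : (b : ℝ) < N := by exact_mod_cast hb
  have hN0 : (0 : ℝ) < N := by linarith
  have hNn' : (N : ℝ) ≤ n := by exact_mod_cast hNn
  have hNb : (0 : ℝ) < N - b := by linarith
  have hlogn : 0 < Real.log n := Real.log_pos (by linarith)
  set w : ℝ := (b : ℝ) / (N - b : ℝ)
  have hw : 0 < w := by positivity
  set r : ℝ := (1 - ε') / ε'
  have hr : 1 < r := by
    rw [lt_div_iff₀ h0]; linarith
  have hlr : 0 < Real.log r := Real.log_pos hr
  have hlw : (b : ℝ) / N ≤ Real.log (1 + w) := by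
    have e : 1 + w = (1 - (b : ℝ) / N)⁻¹ := by simp only [w]; field_simp; ring
    rw [e, Real.log_inv]
    have : 0 < 1 - (b : ℝ) / N := by
      rw [sub_pos, div_lt_one hN0]; exact hbN
    linarith [Real.log_le_sub_one_of_pos this]
  have hbNpos : 0 < (b : ℝ) / N := by positivity
  have hlw0 : 0 < Real.log (1 + w) := by linarith
  -- Chosen so that (1+w)^(s+1) just exceeds r = (1-ε')/ε'. Then 1 + 1/r = 1/(1-ε'), which yields
  -- the term -log(1-ε') of the entropy.
  set s : ℕ := ⌈Real.log r / Real.log (1 + w)⌉₊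
  have hs1 : Real.log r / Real.log (1 + w) ≤ s := Nat.le_ceil _
  have hs2 : (s : ℝ) < Real.log r / Real.log (1 + w) + 1 := Nat.ceil_lt_add_one (by positivity)
  have hrs : r ≤ (1 + w) ^ (s + 1) := by
    rw [← Real.log_le_log_iff (by linarith) (by positivity), Real.log_pow]
    rw [div_le_iff₀ hlw0] at hs1
    push_cast
    nlinarith
  have hs3 : ((s + 1 : ℕ) : ℝ) ≤ N * Real.log r / b + 2 := by
    have : Real.log r / Real.log (1 + w) ≤ N * Real.log r / b := by
      calc Real.log r / Real.log (1 + w) ≤ Real.log r / (b / N) := by gcongr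
        _ = _ := by field_simp
    push_cast
    linarith
  have hmain := card_badDiff_le hb M (q₀ := ((n : ℝ) ^ 60)⁻¹) (by positivity) s hk
  refine hmain.trans ?_
  have hA : (n : ℝ) ^ 10 = Real.exp (10 * Real.log n) := by
    rw [mul_comm, Real.exp_mul, Real.exp_log hn0]; norm_cast
  have hB : (1 + 1 / (1 + w) ^ (s + 1)) ^ N ≤ Real.exp (N * -Real.log (1 - ε')) := by
    have e1 : 1 + 1 / (1 + w) ^ (s + 1) ≤ 1 + 1 / r := by gcongr
    have e2 : 1 + 1 / r = (1 - ε')⁻¹ := by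
      have : (1 - ε') ≠ 0 := by linarith
      simp only [r]; field_simp; ring
    rw [mul_comm, Real.exp_mul, Real.exp_neg, Real.exp_log (by linarith), Real.rpow_natCast, ← e2]
    gcongr
  have hC : ((N + 1) * (n : ℝ) ^ 10 / ((n : ℝ) ^ 60)⁻¹) ^ (s + 1) ≤
      Real.exp (N * (ε' * Real.log r) + 144 * Real.log n) := by
    -- 72 = 2 + 10 + 60, from N + 1, the kernel size and q₀.
    have e1 : (N + 1) * (n : ℝ) ^ 10 / ((n : ℝ) ^ 60)⁻¹ ≤ (n : ℝ) ^ 72 := by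
      rw [div_inv_eq_mul]
      have : (N : ℝ) + 1 ≤ n ^ 2 := by nlinarith
      calc (N + 1) * (n : ℝ) ^ 10 * n ^ 60 ≤ n ^ 2 * n ^ 10 * n ^ 60 := by gcongr
        _ = _ := by ring
    have e2 : ((n : ℝ) ^ 72) = Real.exp (72 * Real.log n) := by
      rw [mul_comm, Real.exp_mul, Real.exp_log hn0]; norm_cast
    calc _ ≤ (Real.exp (72 * Real.log n)) ^ (s + 1) := by rw [← e2]; gcongr
      _ = Real.exp (((s + 1 : ℕ) : ℝ) * (72 * Real.log n)) := by rw [Real.exp_nat_mul]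
      _ ≤ _ := by
        refine Real.exp_le_exp.2 ?_
        have e3 : Real.log n * (100 / b) ≤ ε' := by
          rw [mul_div_assoc', div_le_iff₀ hb']
          rw [div_le_iff₀ h0] at hbl
          linarith
        -- Here the constant 100 in the block length matters: it exceeds 72, so the Markov factor
        -- costs no more than the remaining entropy term ε' log r.
        have e4 : N * Real.log r / b * (72 * Real.log n) ≤ N * (ε' * Real.log r) := by
          have h5 : N * Real.log r / b * (72 * Real.log n) =
              (N * Real.log r * (72 / 100)) * (Real.log n * (100 / b)) := by field_simp
          have h6 : 0 ≤ N * Real.log r * (72 / 100) := by positivity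
          rw [h5]
          refine (mul_le_mul_of_nonneg_left e3 h6).trans ?_
          have h7 : 0 ≤ N * Real.log r * ε' := by positivity
          nlinarith
        have h8 : (0 : ℝ) ≤ 72 * Real.log n := by positivity
        nlinarith [mul_le_mul_of_nonneg_right hs3 h8]
  have hent : Real.binEntropy ε' = -Real.log (1 - ε') + ε' * Real.log r := by
    simp only [r]
    rw [Real.binEntropy_eq_negMulLog_add_negMulLog_one_sub, Real.log_div (by linarith) h0.ne']
    simp only [Real.negMulLog]
    ring
  calc _ ≤ Real.exp (10 * Real.log n) * (Real.exp (N * -Real.log (1 - ε')) *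
        Real.exp (N * (ε' * Real.log r) + 144 * Real.log n)) := by
        rw [hA] at hC ⊢
        gcongr
    _ = _ := by
        rw [← Real.exp_add, ← Real.exp_add, hent]
        congr 1
        ring

/-- Each nonzero bit of `x` replaces log(1-p) by the smaller log p, so the extremal weight is nq.
The slack γ covers the rounding in `onesCount`. -/
theorem exp_le_prod_bitProb {n m K : ℕ} {p q γ : ℝ} (hp0 : 0 < p) (hp : p < 1 / 2)
    (hK1 : p ≤ (K : ℝ) / 2 ^ m) (hK2 : (K : ℝ) / 2 ^ m < 1)
    (hK3 : Real.log (1 - p) - γ ≤ Real.log (1 - K / 2 ^ m)) (hγ : 0 ≤ γ) (x : Bits n)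
    (hx : (hammingNorm x : ℝ) ≤ n * q) :
    Real.exp (-(n * (crossEntropy q p + γ))) ≤ ∏ j, bitProb K m (x j) := by
  have hP : ∀ j, 0 < bitProb K m (x j) := fun j => by
    unfold bitProb; split_ifs <;> linarith
  rw [← Real.exp_log (Finset.prod_pos fun j _ => hP j), Real.log_prod (fun j _ => (hP j).ne')]
  refine Real.exp_le_exp.2 ?_
  have hterm : ∀ j, Real.log (1 - p) - γ +
      (if x j ≠ 0 then Real.log p - Real.log (1 - p) else 0) ≤ Real.log (bitProb K m (x j)) := by
    intro j
    rcases zmod_two_cases (x j) with h | h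
    · simp only [h, bitProb, ne_eq, not_true_eq_false, if_false, zero_ne_one]
      linarith
    · simp only [h, bitProb, ne_eq, one_ne_zero, not_false_eq_true, if_true]
      have := Real.log_le_log hp0 hK1
      linarith
  have hsum := Finset.sum_le_sum (s := Finset.univ) fun j _ => hterm j
  refine le_trans ?_ hsum
  rw [Finset.sum_add_distrib, Finset.sum_const, Finset.card_univ, Fintype.card_fin, nsmul_eq_mul,
    ← Finset.sum_filter, Finset.sum_const, nsmul_eq_mul]
  change _ ≤ _ + (hammingNorm x : ℝ) * _
  have hlog : Real.log p ≤ Real.log (1 - p) := Real.log_le_log hp0 (by linarith)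
  unfold crossEntropy
  nlinarith

theorem eventually_log_add_le (C D : ℝ) {c : ℝ} (hc : 0 < c) :
    ∀ᶠ n : ℕ in atTop, C * Real.log n + D ≤ c * n := by
  have h1 : (fun x : ℝ => C * Real.log x + D) =o[atTop] (fun x : ℝ => x) := by
    refine (Real.isLittleO_log_id_atTop.const_mul_left C).add ?_
    exact (Asymptotics.isLittleO_const_id_atTop D)
  have h2 := (h1.bound hc).natCast_atTop
  filter_upwards [h2] with n hn
  have := (le_abs_self _).trans hn
  rwa [Real.norm_eq_abs, abs_of_nonneg (Nat.cast_nonneg n)] at this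

theorem le_blockLen {ε' : ℝ} (h0 : 0 < ε') {n : ℕ} (hn : 1 ≤ n) :
    100 * Real.log n / ε' ≤ blockLen ε' n := by
  refine le_trans ?_ (Nat.le_ceil _)
  have hlog : 0 ≤ Real.log n := Real.log_nonneg (by exact_mod_cast hn)
  have h2 : Real.log 2 ≤ 1 := by linarith [Real.log_two_lt_d9]
  have : Real.log n ≤ Real.logb 2 n := by
    unfold Real.logb
    rw [le_div_iff₀ (Real.log_pos (by norm_num))]
    nlinarith
  gcongr

theorem blockLen_le {ε' : ℝ} (h0 : 0 < ε') {n : ℕ} (hn : 1 ≤ n) :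
    (blockLen ε' n : ℝ) ≤ 100 * Real.log n / (ε' * Real.log 2) + 1 := by
  have hlog : 0 ≤ Real.log n := Real.log_nonneg (by exact_mod_cast hn)
  have h2 : 0 < Real.log 2 := Real.log_pos (by norm_num)
  have e : 100 * Real.logb 2 n / ε' = 100 * Real.log n / (ε' * Real.log 2) := by
    unfold Real.logb; field_simp
  have := Nat.ceil_lt_add_one (a := 100 * Real.logb 2 n / ε') (by rw [e]; positivity)
  rw [e] at this
  unfold blockLen
  rw [e]
  exact this.le

theorem tendsto_blockLen {ε' : ℝ} (h0 : 0 < ε') :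
    Tendsto (fun n => (blockLen ε' n : ℝ)) atTop atTop := by
  have h1 : Tendsto (fun n : ℕ => 100 * Real.log n / ε') atTop atTop :=
    ((Real.tendsto_log_atTop.comp tendsto_natCast_atTop_atTop).const_mul_atTop
      (by norm_num : (0 : ℝ) < 100)).atTop_div_const h0
  refine tendsto_atTop_mono' _ ?_ h1
  filter_upwards [eventually_ge_atTop 1] with n hn
  exact le_blockLen h0 hn

theorem onesCount_div_bounds {p : ℝ} (hp0 : 0 < p) (m : ℕ) :
    p ≤ (onesCount p m : ℝ) / 2 ^ m ∧ (onesCount p m : ℝ) / 2 ^ m ≤ p + (1 / 2) ^ m := by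
  have h2 : (0 : ℝ) < 2 ^ m := by positivity
  constructor
  · rw [le_div_iff₀ h2]; exact Nat.le_ceil _
  · rw [div_le_iff₀ h2, add_mul, ← mul_pow]
    have := Nat.ceil_lt_add_one (a := p * 2 ^ m) (by positivity)
    norm_num
    exact this.le

theorem eventually_onesCount {p γ : ℝ} (hp0 : 0 < p) (hp : p < 1 / 2) (hγ : 0 < γ) :
    ∀ᶠ m : ℕ in atTop, (onesCount p m : ℝ) / 2 ^ m ≤ 3 / 4 ∧
      Real.log (1 - p) - γ ≤ Real.log (1 - onesCount p m / 2 ^ m) := by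
  have h1 : Tendsto (fun m : ℕ => p + (1 / 2 : ℝ) ^ m) atTop (𝓝 (p + 0)) :=
    (tendsto_pow_atTop_nhds_zero_of_lt_one (by norm_num) (by norm_num)).const_add p
  have h2 : Tendsto (fun m : ℕ => (onesCount p m : ℝ) / 2 ^ m) atTop (𝓝 p) := by
    rw [add_zero] at h1
    exact tendsto_of_tendsto_of_tendsto_of_le_of_le tendsto_const_nhds h1
      (fun m => (onesCount_div_bounds hp0 m).1) (fun m => (onesCount_div_bounds hp0 m).2)
  have h3 : Tendsto (fun m : ℕ => Real.log (1 - onesCount p m / 2 ^ m)) atTop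
      (𝓝 (Real.log (1 - p))) := (h2.const_sub 1).log (by linarith)
  have h4 := h2.eventually (gt_mem_nhds (show p < 3 / 4 by linarith))
  have h5 := h3.eventually (lt_mem_nhds (show Real.log (1 - p) - γ < Real.log (1 - p) by linarith))
  filter_upwards [h4, h5] with m a b
  exact ⟨a.le, b.le⟩

theorem card_ker_le {b m n : ℕ} {M : Matrix (Fin m) (Fin b) (ZMod 2)} (hM : PairBalanced M)
    (hn : 1 ≤ n) (h : ((b : ℝ) - m) * Real.log 2 ≤ 10 * Real.log n) :
    ((Finset.univ.filter fun v : Bits b => M.mulVec v = 0).card : ℝ) ≤ (n : ℝ) ^ 10 := by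
  have hn0 : (0 : ℝ) < n := by exact_mod_cast hn
  have h1 : ((Finset.univ.filter fun v : Bits b => M.mulVec v = 0).card : ℝ) * 2 ^ m = 2 ^ b := by
    exact_mod_cast card_fibre_mul hM 0
  refine le_of_mul_le_mul_right ?_ (show (0 : ℝ) < 2 ^ m by positivity)
  rw [h1, ← Real.log_le_log_iff (by positivity) (by positivity), Real.log_mul (by positivity)
    (by positivity), Real.log_pow, Real.log_pow, Real.log_pow]
  push_cast
  linarith

/-- Bounds the relative variance, with q₀ = n⁻⁶⁰ and the bad differences contributing another n⁻⁶⁰.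
-/
theorem one_add_div_pow_sub_one_le {n : ℕ} (hn : 1 ≤ n) {ρ : ℝ} (hρ : 0 < ρ)
    (hnρ : 2 / ρ + 1 ≤ n) :
    (1 + ((n : ℝ) ^ 60)⁻¹ / ρ) ^ n - 1 + ((n : ℝ) ^ 60)⁻¹ ≤ ((n : ℝ) ^ 58)⁻¹ := by
  have hn1 : (1 : ℝ) ≤ n := by exact_mod_cast hn
  have hn0 : (0 : ℝ) < n := by linarith
  set t : ℝ := n * (((n : ℝ) ^ 60)⁻¹ / ρ)
  have ht : t = ((n : ℝ) ^ 59)⁻¹ / ρ := by simp only [t]; field_simp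
  have ht0 : 0 ≤ t := by positivity
  have hinv : ((n : ℝ) ^ 59)⁻¹ ≤ (n : ℝ)⁻¹ := by
    refine inv_anti₀ hn0 (le_self_pow₀ hn1 (by norm_num))
  have hρn : (n : ℝ)⁻¹ / ρ ≤ 1 := by
    rw [div_le_one hρ, inv_le_comm₀ hn0 hρ]
    have : ρ⁻¹ ≤ 2 / ρ := by rw [← one_div]; gcongr; norm_num
    linarith
  have ht1 : t ≤ 1 := by
    rw [ht]
    exact le_trans (by gcongr) hρn
  have h1 : (1 + ((n : ℝ) ^ 60)⁻¹ / ρ) ^ n ≤ 1 + 2 * t := by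
    have h2 : (1 + ((n : ℝ) ^ 60)⁻¹ / ρ) ^ n ≤ Real.exp t := by
      rw [Real.exp_nat_mul]
      refine pow_le_pow_left₀ (by positivity) ?_ _
      rw [add_comm]; exact Real.add_one_le_exp _
    have h3 : Real.exp t ≤ 1 + 2 * t := by
      have := Real.abs_exp_sub_one_le (x := t) (by rwa [abs_of_nonneg ht0])
      rw [abs_of_nonneg ht0] at this
      linarith [le_abs_self (Real.exp t - 1)]
    exact h2.trans h3
  have h4 : ((n : ℝ) ^ 60)⁻¹ ≤ ((n : ℝ) ^ 59)⁻¹ :=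
    inv_anti₀ (by positivity) (pow_le_pow_right₀ hn1 (by norm_num))
  have h5 : ((n : ℝ) ^ 58)⁻¹ = n * ((n : ℝ) ^ 59)⁻¹ := by field_simp
  have h6 : 0 < ((n : ℝ) ^ 59)⁻¹ := by positivity
  calc _ ≤ 1 + 2 * t - 1 + ((n : ℝ) ^ 59)⁻¹ := by gcongr
    _ = (2 / ρ + 1) * ((n : ℝ) ^ 59)⁻¹ := by rw [ht]; ring
    _ ≤ _ := by rw [h5]; gcongr

/-- The failure probability at blocklength `n` is at most `1 / n²` once `n` is large. -/
theorem ensembleProb_ge_of_large {n N b m K : ℕ} {p q γ ε' : ℝ}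
    {M : Matrix (Fin m) (Fin b) (ZMod 2)} (hM : PairBalanced M)
    (hp0 : 0 < p) (hp : p < 1 / 2) (h0 : 0 < ε') (h1 : ε' < 1 / 2) (hγ : 0 ≤ γ)
    (hn : 2 ≤ n) (hb : 2 ≤ b) (hbN : b < N) (hNn : N ≤ n)
    (hbl : 100 * Real.log n / ε' ≤ b)
    (hker : ((b : ℝ) - m) * Real.log 2 ≤ 10 * Real.log n)
    (hK1 : p ≤ (K : ℝ) / 2 ^ m) (hK2 : (K : ℝ) / 2 ^ m ≤ 3 / 4)
    (hK3 : Real.log (1 - p) - γ ≤ Real.log (1 - K / 2 ^ m))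
    (hnp : 64 / p + 1 ≤ n)
    (hexp : N * Real.binEntropy ε' + 154 * Real.log n + b * Real.log 2 - N * Real.log 2 +
      n * (crossEntropy q p + γ) ≤ -(60 * Real.log n))
    (x : Bits n) (hx : (hammingNorm x : ℝ) ≤ n * q) :
    1 - 1 / (n : ℝ) ^ 2 ≤ ensembleProb (fun ω : Ensemble n N b m K =>
      ∃ η ∈ eligible ω.1 (decoderMaps M ω.2) x,
        idealVec (decoderMaps M ω.2) x + η ∈ generated ω.1 ∧
        ∃ τ : ℝ, 0 < τ ∧ τ ≤ 1 / ((n : ℝ) * 2 ^ b) ∧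
          (expurgated ω.1 (decoderMaps M ω.2) x τ).Nonempty ∧
          idealVec (decoderMaps M ω.2) x + η =
            distVec ω.1 (uniformDist (expurgated ω.1 (decoderMaps M ω.2) x τ))) := by
  have hn2 : (2 : ℝ) ≤ n := by exact_mod_cast hn
  have hn1 : (1 : ℝ) ≤ n := by linarith
  have hn0 : (0 : ℝ) < n := by linarith
  have hK : K ≤ 2 ^ m := by
    have : (K : ℝ) ≤ 2 ^ m := by
      rw [div_le_iff₀ (by positivity)] at hK2
      have : (0 : ℝ) < 2 ^ m := by positivity
      linarith
    exact_mod_cast this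
  have hρ : 0 < p / 2 := by linarith
  -- A one has probability at least p and a zero at least 1/4, which exceeds p/2.
  have hpx : ∀ j, p / 2 ≤ bitProb K m (x j) := fun j => by
    unfold bitProb; split_ifs <;> linarith
  have hprod := exp_le_prod_bitProb hp0 hp hK1 (by linarith) hK3 hγ x hx
  have hPpos : 0 < ∏ j, bitProb K m (x j) := (Real.exp_pos _).trans_le hprod
  have hbad := card_badDiff_le_exp h0 h1 hn (by omega) hbN hNn hbl M
    (card_ker_le hM (by omega) hker)
  have hE2 : ∀ k : ℕ, (2 : ℝ) ^ k = Real.exp (k * Real.log 2) := fun k => by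
    rw [Real.exp_nat_mul, Real.exp_log (by norm_num)]
  have hterm : ((badDiff b N M ((n : ℝ) ^ 60)⁻¹).card : ℝ) * 2 ^ b /
      (2 ^ N * ∏ j, bitProb K m (x j)) ≤ ((n : ℝ) ^ 60)⁻¹ := by
    rw [div_le_iff₀ (by positivity)]
    have e60 : ((n : ℝ) ^ 60)⁻¹ = Real.exp (-(60 * Real.log n)) := by
      rw [Real.exp_neg, mul_comm, Real.exp_mul, Real.exp_log hn0]; norm_cast
    calc ((badDiff b N M ((n : ℝ) ^ 60)⁻¹).card : ℝ) * 2 ^ b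
        ≤ Real.exp (N * Real.binEntropy ε' + 154 * Real.log n) * Real.exp (b * Real.log 2) := by
          rw [← hE2 b]; gcongr
      _ ≤ Real.exp (-(60 * Real.log n)) * (Real.exp (N * Real.log 2) *
            Real.exp (-(n * (crossEntropy q p + γ)))) := by
          rw [← Real.exp_add, ← Real.exp_add, ← Real.exp_add]
          refine Real.exp_le_exp.2 ?_
          linarith
      _ ≤ ((n : ℝ) ^ 60)⁻¹ * (2 ^ N * ∏ j, bitProb K m (x j)) := by
          rw [← e60, ← hE2 N]; gcongr
  have hnp' : 2 / (p / 2) + 1 ≤ n := by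
    have : 2 / (p / 2) ≤ 64 / p := by
      rw [div_div_eq_mul_div]; gcongr; norm_num
    linarith
  have hκ : (1 + ((n : ℝ) ^ 60)⁻¹ / (p / 2)) ^ n - 1 +
      ((badDiff b N M ((n : ℝ) ^ 60)⁻¹).card : ℝ) * 2 ^ b /
        (2 ^ N * ∏ j, bitProb K m (x j)) ≤ ((n : ℝ) ^ 58)⁻¹ :=
    (add_le_add_right hterm _).trans (one_add_div_pow_sub_one_le (by omega) hρ hnp')
  have hξ : 4 * n * ((n : ℝ) ^ 11)⁻¹ * (1 + n ^ 4 / (p / 2)) ≤ 1 / (4 * (n : ℝ) ^ 4) := by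
    have h4 : (1 : ℝ) ≤ n ^ 4 := one_le_pow₀ hn1
    have h5 : 1 + (n : ℝ) ^ 4 / (p / 2) ≤ 4 * n ^ 4 / p := by
      rw [div_div_eq_mul_div, ← sub_nonneg]
      have e : 4 * (n : ℝ) ^ 4 / p - (1 + n ^ 4 * 2 / p) = (2 * n ^ 4 - p) / p := by
        field_simp; ring
      rw [e]
      exact div_nonneg (by linarith) hp0.le
    calc 4 * n * ((n : ℝ) ^ 11)⁻¹ * (1 + n ^ 4 / (p / 2))
        ≤ 4 * n * ((n : ℝ) ^ 11)⁻¹ * (4 * n ^ 4 / p) := by gcongr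
      _ = (64 / p * (n ^ 2 : ℝ)⁻¹) * (1 / (4 * (n : ℝ) ^ 4)) := by field_simp; norm_num
      _ ≤ 1 * (1 / (4 * (n : ℝ) ^ 4)) := by
          gcongr
          rw [mul_inv_le_iff₀ (by positivity), one_mul]
          have : (n : ℝ) ≤ n ^ 2 := le_self_pow₀ hn1 (by norm_num)
          linarith
      _ = _ := one_mul _
  have hmain := ensembleProb_eligible_ge hM hb hn hbN.le hK x hρ
    (q₀ := ((n : ℝ) ^ 60)⁻¹) (by positivity) hpx hκ (ξ := ((n : ℝ) ^ 11)⁻¹) (by positivity) hξ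
  refine le_trans ?_ hmain
  -- The union bound over blocks with κ = n⁻⁵⁸ and ξ = n⁻¹¹; this is far below the required n⁻².
  have e : (n : ℝ) * (((n : ℝ) ^ 58)⁻¹ / (((n : ℝ) ^ 11)⁻¹) ^ 2) = 1 / (n : ℝ) ^ 35 := by
    field_simp
  rw [e]
  have : 1 / (n : ℝ) ^ 35 ≤ 1 / (n : ℝ) ^ 2 :=
    one_div_le_one_div_of_le (by positivity) (pow_le_pow_right₀ hn1 (by norm_num))
  linarith

theorem ensembleProb_nonneg {n N b m K : ℕ} (E : Ensemble n N b m K → Prop) :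
    0 ≤ ensembleProb E := by
  unfold ensembleProb; positivity

/-- Of the margin 3γ, one γ pays for rounding in the validity probability, and 2γn absorbs every
logarithmic term. -/
theorem eventually_numeric {p q γ ε' R : ℝ} (hR0 : 0 < R) (h0 : 0 < ε')
    (hγ : 0 < γ) (hgap : crossEntropy q p + 3 * γ ≤ R * (Real.log 2 - Real.binEntropy ε')) :
    ∀ᶠ n : ℕ in atTop, blockLen ε' n < codeLen R n ∧
      (codeLen R n : ℝ) * Real.binEntropy ε' + 154 * Real.log n + blockLen ε' n * Real.log 2 -
        codeLen R n * Real.log 2 + n * (crossEntropy q p + γ) ≤ -(60 * Real.log n) := by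
  have h2 : 0 < Real.log 2 := Real.log_pos (by norm_num)
  filter_upwards [eventually_log_add_le (100 / (ε' * Real.log 2)) 2 hR0,
    eventually_log_add_le (214 + 100 / ε') (Real.log 2) (show 0 < 2 * γ by linarith),
    eventually_ge_atTop 1] with n ha hb hn
  have hble := blockLen_le h0 hn
  have hN : (n : ℝ) * R ≤ codeLen R n := Nat.le_ceil _
  constructor
  · have : (blockLen ε' n : ℝ) < codeLen R n := by
      have e : 100 * Real.log n / (ε' * Real.log 2) = 100 / (ε' * Real.log 2) * Real.log n := by
        ring
      rw [e] at hble
      linarith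
    exact_mod_cast this
  · have e1 : (blockLen ε' n : ℝ) * Real.log 2 ≤ 100 / ε' * Real.log n + Real.log 2 := by
      calc (blockLen ε' n : ℝ) * Real.log 2
          ≤ (100 * Real.log n / (ε' * Real.log 2) + 1) * Real.log 2 := by gcongr
        _ = _ := by field_simp
    have hent : Real.binEntropy ε' ≤ Real.log 2 := Real.binEntropy_le_log_two
    have e2 : (n : ℝ) * R * (Real.log 2 - Real.binEntropy ε') ≤
        codeLen R n * (Real.log 2 - Real.binEntropy ε') := by
      gcongr
    have e3 : (n : ℝ) * (crossEntropy q p + 3 * γ) ≤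
        n * (R * (Real.log 2 - Real.binEntropy ε')) := by gcongr
    nlinarith

theorem eventually_ker_bound {ε' : ℝ} (h0 : 0 < ε') (h1 : ε' < 1 / 2) {b' : ℕ → ℕ}
    (hlim : Tendsto (fun n => (b' n : ℝ) / (blockLen ε' n : ℝ)) atTop (𝓝 1)) :
    ∀ᶠ n : ℕ in atTop, ((blockLen ε' n : ℝ) - b' n) * Real.log 2 ≤ 10 * Real.log n := by
  have h2 : 0 < Real.log 2 := Real.log_pos (by norm_num)
  have h3 := hlim.eventually (lt_mem_nhds (show 1 - ε' / 20 < 1 by linarith))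
  have h4 := (tendsto_blockLen h0).eventually (eventually_ge_atTop 1)
  filter_upwards [h3, h4, eventually_ge_atTop 2] with n hr hb1 hn
  have hb0 : (0 : ℝ) < blockLen ε' n := by linarith
  have hlog : Real.log 2 ≤ Real.log n := Real.log_le_log (by norm_num) (by exact_mod_cast hn)
  rw [lt_div_iff₀ hb0] at hr
  have hble := blockLen_le h0 (show 1 ≤ n by omega)
  have e1 : (blockLen ε' n : ℝ) - b' n ≤ ε' / 20 * blockLen ε' n := by linarith
  calc ((blockLen ε' n : ℝ) - b' n) * Real.log 2
      ≤ (ε' / 20 * blockLen ε' n) * Real.log 2 := by gcongr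
    _ ≤ (ε' / 20 * (100 * Real.log n / (ε' * Real.log 2) + 1)) * Real.log 2 := by gcongr
    -- With b of order 100 log n/ε', a deficit ratio of ε'/20 costs 5 log n, so the kernel is
    -- polynomial in n.
    _ = 5 * Real.log n + ε' / 20 * Real.log 2 := by field_simp; ring
    _ ≤ _ := by nlinarith

theorem tendsto_of_ratio {ε' : ℝ} (h0 : 0 < ε') {b' : ℕ → ℕ}
    (hlim : Tendsto (fun n => (b' n : ℝ) / (blockLen ε' n : ℝ)) atTop (𝓝 1)) :
    Tendsto b' atTop atTop := by
  have hb := tendsto_blockLen h0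
  have h1 : Tendsto (fun n => (b' n : ℝ) / (blockLen ε' n : ℝ) * blockLen ε' n) atTop atTop :=
    hlim.pos_mul_atTop (by norm_num) hb
  rw [← tendsto_natCast_atTop_iff (R := ℝ)]
  refine h1.congr' ?_
  filter_upwards [hb.eventually (eventually_ge_atTop 1)] with n hn
  have : (blockLen ε' n : ℝ) ≠ 0 := by linarith
  field_simp

end PrivateDecoding

end

/-! ### Choice of parameters and conclusion -/

open PrivateDecoding in
theorem mainTheorem4 (p : ℝ) (hp0 : 0 < p) (hp : p < 1 / 2) :
    ∃ ε₀ : ℝ, 0 < ε₀ ∧ ∀ ε : ℝ, 0 < ε → ε ≤ ε₀ → p + ε ≤ 1 / 2 →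
      ∀ R : ℝ, R = H2 (p + ε) →
      ∀ ε' : ℝ, 0 ≤ ε' → ε' < 1 / 2 → H2 ε' = (R - H2 (p + ε / 2)) / 2 →
      ∀ (b' : ℕ → ℕ) (M : (n : ℕ) → Matrix (Fin (b' n)) (Fin (blockLen ε' n)) (ZMod 2)),
        (∀ n, PairBalanced (M n)) →
        Tendsto (fun n => (b' n : ℝ) / (blockLen ε' n : ℝ)) atTop (𝓝 1) →
        ∃ δ : ℕ → ℝ, Tendsto δ atTop (𝓝 0) ∧
          ∀ n : ℕ, 1 ≤ n → ∀ x : Bits n, (hammingNorm x : ℝ) ≤ n * (p + ε / 2) →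
            1 - (1 + δ n) / (n : ℝ) ^ 2 ≤
              ensembleProb (fun ω : Ensemble n (codeLen R n) (blockLen ε' n) (b' n)
                  (onesCount p (b' n)) =>
                ∃ η ∈ eligible ω.1 (decoderMaps (M n) ω.2) x,
                  idealVec (decoderMaps (M n) ω.2) x + η ∈ generated ω.1 ∧
                  ∃ τ : ℝ, 0 < τ ∧ τ ≤ 1 / ((n : ℝ) * 2 ^ blockLen ε' n) ∧
                    (expurgated ω.1 (decoderMaps (M n) ω.2) x τ).Nonempty ∧
                    idealVec (decoderMaps (M n) ω.2) x + η =
                      distVec ω.1 (uniformDist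
                        (expurgated ω.1 (decoderMaps (M n) ω.2) x τ))) := by
  obtain ⟨ε₀, hε₀, hgap⟩ := exists_entropy_gap hp0 hp
  refine ⟨ε₀, hε₀, fun ε hε hεε₀ hpε R hR ε' h0 h1 hε' b' M hM hlim => ?_⟩
  have hgap := hgap ε hε hεε₀
  have hl2 : 0 < Real.log 2 := Real.log_pos (by norm_num)
  have hRlog : R * Real.log 2 = Real.binEntropy (p + ε) := by
    rw [hR]; unfold H2; field_simp
  have hε'log : 2 * Real.binEntropy ε' =
      Real.binEntropy (p + ε) - Real.binEntropy (p + ε / 2) := by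
    have key : ∀ X Y Z : ℝ, X / Real.log 2 = (Y / Real.log 2 - Z / Real.log 2) / 2 →
        2 * X = Y - Z := by
      intro X Y Z h
      field_simp at h
      linarith
    rw [hR] at hε'
    exact key _ _ _ hε'
  have hmono : Real.binEntropy (p + ε / 2) < Real.binEntropy (p + ε) :=
    Real.binEntropy_strictMonoOn ⟨by linarith, by norm_num; linarith⟩
      ⟨by linarith, by norm_num; linarith⟩ (by linarith)
  have hε'0 : 0 < ε' := by
    rcases h0.lt_or_eq with h | h
    · exact h
    · rw [← h, Real.binEntropy_zero] at hε'log
      linarith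
  have hR1 : R ≤ 1 := by
    refine le_of_mul_le_mul_right ?_ hl2
    rw [hRlog, one_mul]
    exact Real.binEntropy_le_log_two
  have hR0 : 0 < R := by
    refine pos_of_mul_pos_left ?_ hl2.le
    rw [hRlog]
    exact Real.binEntropy_pos (by linarith) (by linarith)
  have hent0 : 0 ≤ Real.binEntropy ε' := by linarith
  set Γ : ℝ := R * (Real.log 2 - Real.binEntropy ε') - crossEntropy (p + ε / 2) p
  -- Since R ≤ 1, the first term of `Γ` is at least h(p+ε) - h(ε') = (h(p+ε) + h(p+ε/2))/2, so the
  -- entropy gap applies.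
  have hΓ : 0 < Γ := by
    have : R * Real.binEntropy ε' ≤ Real.binEntropy ε' := mul_le_of_le_one_left hent0 hR1
    simp only [Γ]
    rw [mul_sub, hRlog]
    linarith
  have hγ : 0 < Γ / 3 := by linarith
  have hev : ∀ᶠ n : ℕ in atTop, ∀ x : Bits n, (hammingNorm x : ℝ) ≤ n * (p + ε / 2) →
      1 - 1 / (n : ℝ) ^ 2 ≤
              ensembleProb (fun ω : Ensemble n (codeLen R n) (blockLen ε' n) (b' n)
                  (onesCount p (b' n)) =>
                ∃ η ∈ eligible ω.1 (decoderMaps (M n) ω.2) x,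
                  idealVec (decoderMaps (M n) ω.2) x + η ∈ generated ω.1 ∧
                  ∃ τ : ℝ, 0 < τ ∧ τ ≤ 1 / ((n : ℝ) * 2 ^ blockLen ε' n) ∧
                    (expurgated ω.1 (decoderMaps (M n) ω.2) x τ).Nonempty ∧
                    idealVec (decoderMaps (M n) ω.2) x + η =
                      distVec ω.1 (uniformDist
                        (expurgated ω.1 (decoderMaps (M n) ω.2) x τ))) := by
    have hnum := eventually_numeric (q := p + ε / 2) (p := p) hR0 hε'0 hγ
      (by simp only [Γ]; linarith)
    have hker := eventually_ker_bound hε'0 h1 hlim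
    have hK := (tendsto_of_ratio hε'0 hlim).eventually (eventually_onesCount hp0 hp hγ)
    have hb := (tendsto_blockLen hε'0).eventually (eventually_ge_atTop 2)
    have hnp := (tendsto_natCast_atTop_atTop (R := ℝ)).eventually (eventually_ge_atTop (64 / p + 1))
    filter_upwards [hnum, hker, hK, hb, hnp, eventually_ge_atTop 2]
      with n hnum hker hK hb hnp hn x hx
    refine ensembleProb_ge_of_large (hM n) hp0 hp hε'0 h1 hγ.le hn (by exact_mod_cast hb) hnum.1 ?_
      (le_blockLen hε'0 (by omega)) hker (onesCount_div_bounds hp0 _).1 hK.1 hK.2 hnp hnum.2 x hx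
    exact Nat.ceil_le.2 (mul_le_of_le_one_right (Nat.cast_nonneg n) hR1)
  obtain ⟨n₀, hn₀⟩ := eventually_atTop.1 hev
  -- The threshold `n₀` is uniform in `x`. Below it, δ = n² makes the claimed lower bound negative.
  refine ⟨fun n => if n₀ ≤ n then 0 else (n : ℝ) ^ 2, ?_, fun n hn x hx => ?_⟩
  · refine tendsto_const_nhds.congr' ?_
    filter_upwards [eventually_ge_atTop n₀] with n hn
    rw [if_pos hn]
  · by_cases h : n₀ ≤ n
    · simp only [h, if_true, add_zero]
      exact hn₀ n h x hx
    · simp only [h, if_false]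
      refine le_trans ?_ (ensembleProb_nonneg _)
      have hn' : (0 : ℝ) < n := by exact_mod_cast hn
      rw [sub_nonpos, le_div_iff₀ (by positivity)]
      linarith
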